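/- Let $s,c,k\ge 0$ be integers and $n=s+c+k$. The sender holds $n$ qubits ($s$ ancillas, $c$ halves of EPR pairs, $k$ logical qubits, in this order) and the receiver holds the other halves of the $c$ EPR pairs. An $[[n,k;c]]$ entanglement-assisted stabilizer code is given by elements $\bar Z_1,\dots,\bar Z_{s+c},\bar X_{s+1},\dots,\bar X_{s+c}$ of the $n$-qubit Pauli group such that all $\bar Z_i$ commute with each other, all $\bar X_j$ commute with each other, $\bar Z_i$ commutes with $\bar X_j$ for $i\neq j$ and anticommutes with it for $i=j$, the $(s+2c)\times 2n$ binary check matrix formed by their binary representations has full row rank, and the stabilizer group $\mathcal S$ on $n+c$ qubits generated by $\bar Z_i\otimes I$ ($i\le s$), $\bar X_{s+j}\otimes X_j$ and $\bar Z_{s+j}\otimes Z_j$ ($1\le j\le c$) does not contain $-I$. Its code space is $\mathcal C(\mathcal S)=\{v\in(\mathbb C^{2})^{\otimes(n+c)}: gv=v \text{ for all } g\in\mathcal S\}$. An encoding circuit for the code is a finite sequence of CNOT, Hadamard and phase gates on the sender's $n$ qubits whose unitary operator $U$ satisfies $UZ_iU^\dagger=\bar Z_i$ for $1\le i\le s+c$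 and $UX_iU^\dagger=\bar X_i$ for $s<i\le s+c$, and for which the $2^k$ vectors $(U\otimes I)\,|0\rangle^{\otimes s}|\Phi^+\rangle^{\otimes c}|x\rangle$, $x\in\{0,1\}^k$, form a basis of $\mathcal C(\mathcal S)$, where $|\Phi^+\rangle=(|00\rangle+|11\rangle)/\sqrt2$ is shared by sender and receiver. Theorem. For every $\alpha>0$ there is a constant $K>0$, depending only on $\alpha$, such that for all $n=s+c+k\ge 2$ with $n-k+c\ge\alpha\log n$, every $[[n,k;c]]$ entanglement-assisted stabilizer code has an encoding circuit with at most $$K\,\frac{n(n-k+c)}{\log n}$$ gates. That is, in the regime $\log n=O(n-k+c)$, the encoding complexity is $O(n(n-k+c)/\log n)$. -/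

import Mathlib

namespace EAQ

open scoped Matrix

/-! ### Qubits, operators and Pauli operators -/

/-- Computational basis labels of a register of qubits indexed by `Q`. -/
abbrev Bits (Q : Type) : Type := Q → Fin 2

/-- State vectors of the register, `ℂ^(2^|Q|)`. -/
abbrev State (Q : Type) : Type := Bits Q → ℂ

/-- Linear operators on the register, as matrices in the computational basis. -/
abbrev Op (Q : Type) : Type := Matrix (Bits Q) (Bits Q) ℂ

/-- The tensor product `⨂ q, A q` of one-qubit operators. -/
def tensorOp {Q : Type} [Fintype Q] (A : Q → Matrix (Fin 2) (Fin 2) ℂ) : Op Q :=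
  Matrix.of fun x y => ∏ q, A q (x q) (y q)

/-- The operator acting as `A` on qubit `q` and as the identity elsewhere. -/
def localOp {Q : Type} [Fintype Q] [DecidableEq Q] (q : Q) (A : Matrix (Fin 2) (Fin 2) ℂ) : Op Q :=
  tensorOp (Function.update (fun _ => 1) q A)

/-- The four one-qubit Pauli labels. -/
inductive PauliLabel : Type
  | I
  | X
  | Y
  | Z

/-- The Pauli matrices. -/
noncomputable def PauliLabel.mat : PauliLabel → Matrix (Fin 2) (Fin 2) ℂ
  | .I => 1
  | .X => !![0, 1; 1, 0]
  | .Y => !![0, -Complex.I; Complex.I, 0]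
  | .Z => !![1, 0; 0, -1]

/-- The `X`-part of the binary representation: `X ↦ (1|0)`, `Y ↦ (1|1)`, `Z ↦ (0|1)`. -/
def PauliLabel.xBit : PauliLabel → ZMod 2
  | .I => 0
  | .X => 1
  | .Y => 1
  | .Z => 0

/-- The `Z`-part of the binary representation. -/
def PauliLabel.zBit : PauliLabel → ZMod 2
  | .I => 0
  | .X => 0
  | .Y => 1
  | .Z => 1

/-- An element `i ^ e ⨂ q, M q` of the Pauli group on the qubits `Q`. -/
structure Pauli (Q : Type) : Type where
  phase : Fin 4
  label : Q → PauliLabel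

/-- The operator `i ^ e ⨂ q, M q`. -/
noncomputable def Pauli.op {Q : Type} [Fintype Q] (g : Pauli Q) : Op Q :=
  (Complex.I ^ (g.phase : ℕ)) • tensorOp fun q => (g.label q).mat

/-- The binary vector `φ(g) = (u | v)`, a row of a check matrix. -/
def Pauli.row {Q : Type} (g : Pauli Q) : Q ⊕ Q → ZMod 2 :=
  Sum.elim (fun q => (g.label q).xBit) (fun q => (g.label q).zBit)

/-- The Pauli operator with label `M` on qubit `q` and the identity elsewhere, with phase `1`. -/
def Pauli.single {Q : Type} [DecidableEq Q] (q : Q) (M : PauliLabel) : Pauli Q :=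
  ⟨0, Function.update (fun _ => PauliLabel.I) q M⟩

/-- The tensor product `g ⊗ h`, with the phase of `g` and the labels `h` on the second register. -/
def Pauli.extend {Q R : Type} (g : Pauli Q) (h : R → PauliLabel) : Pauli (Q ⊕ R) :=
  ⟨g.phase, Sum.elim g.label h⟩

/-! ### Clifford circuits -/

/-- Elementary gates: CNOT (with control `i` and target `j`), Hadamard and phase gate. -/
inductive Gate (Q : Type) : Type
  | cnot (i j : Q) (hij : i ≠ j)
  | hadamard (q : Q)
  | phase (q : Q)

/-- The unitary operator of a gate. -/
noncomputable def Gate.op {Q : Type} [Fintype Q] [DecidableEq Q] : Gate Q → Op Q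
  | .cnot i j _ => Matrix.of fun x y => if x = Function.update y j (y j + y i) then 1 else 0
  | .hadamard q => localOp q (((Real.sqrt 2)⁻¹ : ℂ) • !![1, 1; 1, -1])
  | .phase q => localOp q !![1, 0; 0, Complex.I]

/-- A circuit is a list of gates, the first gate of the list being applied first;
its gate complexity is the length of the list. -/
abbrev Circuit (Q : Type) : Type := List (Gate Q)

/-- The unitary operator of a circuit. -/
noncomputable def Circuit.op {Q : Type} [Fintype Q] [DecidableEq Q] : Circuit Q → Op Q
  | [] => 1
  | g :: C => Circuit.op C * g.op

/-- The operator `U ⊗ I` on a register extended by qubits `R`. -/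
def tensorId {Q R : Type} [Fintype R] [DecidableEq R] (U : Op Q) : Op (Q ⊕ R) :=
  Matrix.of fun x y =>
    U (x ∘ Sum.inl) (y ∘ Sum.inl) * (if x ∘ Sum.inr = y ∘ Sum.inr then 1 else 0)

/-! ### Entanglement-assisted stabilizer codes -/

/-- The sender's `n = s + c + k` qubits: `s` ancillas, `c` halves of EPR pairs and
`k` logical qubits, in this order. -/
abbrev Alice (s c k : ℕ) : Type := Fin s ⊕ Fin c ⊕ Fin k

/-- All `n + c` qubits: the sender's, followed by the receiver's halves of the EPR pairs. -/
abbrev AliceBob (s c k : ℕ) : Type := Alice s c k ⊕ Fin c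

/-- The generators, acting on all `n + c` qubits, that belong to simplified generators
`Zbar`, `Xbar`: `Z̄ᵢ ⊗ I` for the ancillas and `X̄ᵢ ⊗ Xᵢ`, `Z̄ᵢ ⊗ Zᵢ` for the EPR pairs. -/
def fullGenerators {s c k : ℕ} (Zbar : Fin s ⊕ Fin c → Pauli (Alice s c k))
    (Xbar : Fin c → Pauli (Alice s c k)) : Set (Pauli (AliceBob s c k)) :=
  {g | (∃ i : Fin s, g = (Zbar (Sum.inl i)).extend fun _ => PauliLabel.I) ∨
    (∃ i : Fin c, g = (Xbar i).extend (Pauli.single i PauliLabel.X).label) ∨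
    (∃ i : Fin c, g = (Zbar (Sum.inr i)).extend (Pauli.single i PauliLabel.Z).label)}

/-- The stabilizer group generated by `fullGenerators`. (Pauli operators have finite order, so
the generated monoid is the generated group.) -/
noncomputable def stabilizerGroup {s c k : ℕ} (Zbar : Fin s ⊕ Fin c → Pauli (Alice s c k))
    (Xbar : Fin c → Pauli (Alice s c k)) : Submonoid (Op (AliceBob s c k)) :=
  Submonoid.closure (Pauli.op '' fullGenerators Zbar Xbar)

/-- An `[[n, k; c]]` entanglement-assisted stabilizer code with `n = s + c + k`, given by its
simplified stabilizer generators: Pauli operators `Z̄ᵢ` (`i = 1, …, s + c`) and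
`X̄ᵢ` (`i = s + 1, …, s + c`) on the sender's `n` qubits. -/
structure Code (s c k : ℕ) : Type where
  Zbar : Fin s ⊕ Fin c → Pauli (Alice s c k)
  Xbar : Fin c → Pauli (Alice s c k)
  comm_ZZ : ∀ i j, (Zbar i).op * (Zbar j).op = (Zbar j).op * (Zbar i).op
  comm_XX : ∀ i j, (Xbar i).op * (Xbar j).op = (Xbar j).op * (Xbar i).op
  comm_ZX : ∀ i j, i ≠ Sum.inr j → (Zbar i).op * (Xbar j).op = (Xbar j).op * (Zbar i).op
  anticomm_ZX : ∀ j,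
    (Zbar (Sum.inr j)).op * (Xbar j).op = -((Xbar j).op * (Zbar (Sum.inr j)).op)
  /-- the simplified check matrix, with `s + 2c` rows and `2n` columns, has full row rank -/
  indep : LinearIndependent (ZMod 2)
    (Sum.elim (fun i => (Zbar i).row) (fun j => (Xbar j).row))
  /-- the stabilizer group on the `n + c` qubits does not contain `-I` -/
  neg_one_notMem : -1 ∉ stabilizerGroup Zbar Xbar

/-- The code space: the vectors fixed by every element of the stabilizer group. -/
def Code.space {s c k : ℕ} (𝒞 : Code s c k) : Submodule ℂ (State (AliceBob s c k)) where
  carrier := {v | ∀ g ∈ stabilizerGroup 𝒞.Zbar 𝒞.Xbar, g *ᵥ v = v}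
  add_mem' := by
    intro v w hv hw g hg
    rw [Matrix.mulVec_add, hv g hg, hw g hg]
  zero_mem' := by
    intro g _
    exact Matrix.mulVec_zero g
  smul_mem' := by
    intro a v hv g hg
    rw [Matrix.mulVec_smul, hv g hg]

/-- The initial basis state `|0⟩^s ⊗ |Φ⁺⟩^c ⊗ |x₁ … x_k⟩`, where
`|Φ⁺⟩ = (|00⟩ + |11⟩) / √2` is shared between the sender and the receiver. -/
noncomputable def initialState (s c k : ℕ) (x : Bits (Fin k)) : State (AliceBob s c k) :=
  fun y =>
    if (∀ i : Fin s, y (Sum.inl (Sum.inl i)) = 0) ∧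
        (∀ i : Fin c, y (Sum.inl (Sum.inr (Sum.inl i))) = y (Sum.inr i)) ∧
        (∀ i : Fin k, y (Sum.inl (Sum.inr (Sum.inr i))) = x i)
    then ((Real.sqrt 2)⁻¹ : ℂ) ^ c else 0

/-- The position of the `i`-th ancilla or EPR half among the sender's qubits. -/
def position {s c k : ℕ} : Fin s ⊕ Fin c → Alice s c k :=
  Sum.elim Sum.inl fun i => Sum.inr (Sum.inl i)

/-- A circuit `U` on the sender's qubits encodes the code `𝒞` if it conjugates the raw simplified
stabilizers `Zᵢ`, `Xᵢ` to the generators `Z̄ᵢ`, `X̄ᵢ`, and if the images under `U ⊗ I` of the `2^k`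
initial basis states form a basis of the code space. -/
structure Code.IsEncodedBy {s c k : ℕ} (𝒞 : Code s c k) (U : Circuit (Alice s c k)) : Prop where
  map_Z : ∀ i, U.op * (Pauli.single (position i) PauliLabel.Z).op * (U.op)ᴴ = (𝒞.Zbar i).op
  map_X : ∀ i, U.op * (Pauli.single (position (Sum.inr i)) PauliLabel.X).op * (U.op)ᴴ =
    (𝒞.Xbar i).op
  linearIndependent : LinearIndependent ℂ
    (fun x : Bits (Fin k) => tensorId (R := Fin c) U.op *ᵥ initialState s c k x)
  span_eq : Submodule.span ℂ
    (Set.range fun x : Bits (Fin k) => tensorId (R := Fin c) U.op *ᵥ initialState s c k x) = 𝒞.space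

end EAQ

/-! Up to scalars, conjugation by a Clifford circuit acts linearly on binary symplectic vectors and
preserves the symplectic form (`Circuit.symp_act`). The generators of the code give an isotropic
family together with some hyperbolic pairs; since the check matrix has full rank, the family is
completed to r = s + c mutually orthogonal hyperbolic pairs (`exists_hyperbolic`). It then suffices
to find a short circuit carrying the i-th pair to (Z, X) on the i-th position. The encoder is the
inverse of this circuit, preceded by Pauli gates that repair signs (`Circuit.exists_inverse_conj`).
The signs are only ±1 because excluding -I from the stabilizer forces every generator to square to
the identity. Inversion and repair cost a factor 3 and O(n) extra gates.

Gaussian elimination on one pair costs O(n) gates (`exists_circuit_pair`), hence O(nr) in all. The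
logarithm is saved by treating b ≈ (log n)/8 pairs at a time. The 2b vectors of a block assign to
each qubit a column out of 16^b possible ones, and a CNOT between two qubits with equal nonzero
columns erases an X-part or a Z-part. After at most 2n such gates the nonzero columns are distinct,
so the block lives on at most 16^b qubits (`exists_circuit_compress`), where ordinary elimination
costs only O(n). A finished block is orthogonal to the remaining vectors, so these vanish on its
positions and the process continues on the other qubits (`Standardizable.add`). There are about r /
b + 1 blocks of cost O(n). As r ≤ n - k + c, and log n = O(n - k + c) absorbs the additive terms,
the bound follows.

Finally, the initial states span the common fixed space of the raw stabilizers
(`mem_span_initialState_iff`), so any circuit conjugating the raw stabilizers to the generators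
carries them to a basis of the code space. -/

namespace EAQ

open scoped Matrix

/-! ### Tensor products of operators -/

section TensorOp

variable {Q : Type} [Fintype Q]

theorem tensorOp_mul [DecidableEq Q] (A B : Q → Matrix (Fin 2) (Fin 2) ℂ) :
    tensorOp A * tensorOp B = tensorOp fun q => A q * B q := by
  ext x y
  simp only [tensorOp, Matrix.mul_apply, Matrix.of_apply]
  rw [Finset.prod_univ_sum, Fintype.piFinset_univ]
  simp only [Finset.prod_mul_distrib]

theorem tensorOp_smul (c : Q → ℂ) (A : Q → Matrix (Fin 2) (Fin 2) ℂ) :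
    (tensorOp fun q => c q • A q) = (∏ q, c q) • tensorOp A := by
  ext x y
  simp [tensorOp, Finset.prod_mul_distrib]

theorem tensorOp_one [DecidableEq Q] : tensorOp (fun _ : Q => 1) = 1 := by
  ext x y
  simp only [tensorOp, Matrix.of_apply, Matrix.one_apply]
  by_cases h : x = y
  · simp [h]
  · rw [if_neg h]
    obtain ⟨q, hq⟩ := Function.ne_iff.mp h
    exact Finset.prod_eq_zero (Finset.mem_univ q) (if_neg hq)

theorem tensorOp_conjTranspose (A : Q → Matrix (Fin 2) (Fin 2) ℂ) :
    (tensorOp A)ᴴ = tensorOp fun q => (A q)ᴴ := by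
  ext x y
  simp [tensorOp, Matrix.conjTranspose_apply]

variable [DecidableEq Q]

theorem localOp_mul_tensorOp (q : Q) (M : Matrix (Fin 2) (Fin 2) ℂ)
    (A : Q → Matrix (Fin 2) (Fin 2) ℂ) :
    localOp q M * tensorOp A = tensorOp (Function.update A q (M * A q)) := by
  rw [localOp, tensorOp_mul]
  congr 1
  funext r
  rcases eq_or_ne r q with rfl | h <;> simp [*]

theorem tensorOp_mul_localOp (q : Q) (M : Matrix (Fin 2) (Fin 2) ℂ)
    (A : Q → Matrix (Fin 2) (Fin 2) ℂ) :
    tensorOp A * localOp q M = tensorOp (Function.update A q (A q * M)) := by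
  rw [localOp, tensorOp_mul]
  congr 1
  funext r
  rcases eq_or_ne r q with rfl | h <;> simp [*]

theorem tensorOp_update_smul (q : Q) (c : ℂ) (M : Matrix (Fin 2) (Fin 2) ℂ)
    (A : Q → Matrix (Fin 2) (Fin 2) ℂ) :
    tensorOp (Function.update A q (c • M)) = c • tensorOp (Function.update A q M) := by
  have h : Function.update A q (c • M) =
      fun r => (if r = q then c else 1) • Function.update A q M r := by
    funext r
    rcases eq_or_ne r q with rfl | h <;> simp [*]
  rw [h, tensorOp_smul, Finset.prod_ite_eq' Finset.univ q fun _ => c]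
  simp

theorem localOp_mul_localOp (q : Q) (M N : Matrix (Fin 2) (Fin 2) ℂ) :
    localOp q M * localOp q N = localOp q (M * N) := by
  change localOp q M * tensorOp (Function.update (fun _ => 1) q N) = _
  rw [localOp_mul_tensorOp, localOp]
  simp

theorem localOp_one (q : Q) : localOp q (1 : Matrix (Fin 2) (Fin 2) ℂ) = 1 := by
  rw [localOp, ← tensorOp_one]
  congr 1
  exact Function.update_eq_self q _

theorem localOp_conjTranspose (q : Q) (M : Matrix (Fin 2) (Fin 2) ℂ) :
    (localOp q M)ᴴ = localOp q Mᴴ := by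
  rw [localOp, tensorOp_conjTranspose, localOp]
  congr 1
  funext r
  rcases eq_or_ne r q with rfl | h <;> simp [*]

end TensorOp

/-! ### Weyl operators and the symplectic form -/

/-- Binary symplectic vectors, with the `X`-bit and the `Z`-bit of every qubit. -/
abbrev SympVec (Q : Type) : Type := Q → ZMod 2 × ZMod 2

/-- The character `a ↦ (-1) ^ a`. -/
def sgn (a : ZMod 2) : ℤ := if a = 0 then 1 else -1

theorem sgn_add (a b : ZMod 2) : sgn (a + b) = sgn a * sgn b := by
  revert a b; decide

theorem sgn_mul_self (a : ZMod 2) : sgn a * sgn a = 1 := by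
  revert a; decide

theorem sgn_injective : Function.Injective sgn := by
  decide

theorem sgn_sum {ι : Type*} (s : Finset ι) (f : ι → ZMod 2) :
    sgn (∑ i ∈ s, f i) = ∏ i ∈ s, sgn (f i) := by
  classical
  induction s using Finset.induction_on with
  | empty => rfl
  | insert a s ha ih => rw [Finset.sum_insert ha, Finset.prod_insert ha, sgn_add, ih]

/-- The integral matrix `X ^ a Z ^ b`. -/
def weylInt (a : ZMod 2 × ZMod 2) : Matrix (Fin 2) (Fin 2) ℤ :=
  -- `ZMod 2` unfolds to `Fin 2`, which lets exponents and basis bits be combined directly.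
  fun x y => if x = Fin.add y a.1 then sgn (Fin.mul a.2 y) else 0

/-- The one-qubit Weyl operator `X ^ a Z ^ b`. -/
noncomputable def weylOne (a : ZMod 2 × ZMod 2) : Matrix (Fin 2) (Fin 2) ℂ :=
  (weylInt a).map (Int.castRingHom ℂ)

/-- The Weyl operator `⨂ q, X ^ (v q).1 Z ^ (v q).2`. -/
noncomputable def weyl {Q : Type} [Fintype Q] (v : SympVec Q) : Op Q :=
  tensorOp fun q => weylOne (v q)

/-- The one-qubit symplectic form. -/
def sympOne (a b : ZMod 2 × ZMod 2) : ZMod 2 := a.1 * b.2 + a.2 * b.1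

/-- The symplectic form. -/
def symp {Q : Type} [Fintype Q] (u v : SympVec Q) : ZMod 2 := ∑ q, sympOne (u q) (v q)

/-- Over ℤ the identity is settled by enumeration; it is then transported to ℂ entrywise. -/
theorem weylInt_comm : ∀ a b : ZMod 2 × ZMod 2,
    weylInt a * weylInt b = sgn (sympOne a b) • (weylInt b * weylInt a) := by
  decide

theorem weylInt_sq : ∀ a : ZMod 2 × ZMod 2, ∃ c : ℤ, c * c = 1 ∧
    weylInt a * weylInt a = c • 1 := by
  intro a
  refine ⟨sgn (a.1 * a.2), sgn_mul_self _, ?_⟩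
  revert a
  decide

theorem weylOne_comm (a b : ZMod 2 × ZMod 2) :
    weylOne a * weylOne b = (sgn (sympOne a b) : ℂ) • (weylOne b * weylOne a) := by
  simp only [weylOne, ← Matrix.map_mul]
  rw [weylInt_comm]
  ext x y
  rw [Matrix.map_apply, Matrix.smul_apply, Matrix.smul_apply, Matrix.map_apply, smul_eq_mul,
    map_mul, smul_eq_mul]
  rfl

theorem weyl_comm {Q : Type} [Fintype Q] [DecidableEq Q] (u v : SympVec Q) :
    weyl u * weyl v = (sgn (symp u v) : ℂ) • (weyl v * weyl u) := by
  simp only [weyl, tensorOp_mul]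
  simp only [weylOne_comm (u _) (v _)]
  rw [tensorOp_smul, symp, sgn_sum]
  push_cast
  rfl

theorem weyl_sq {Q : Type} [Fintype Q] [DecidableEq Q] (v : SympVec Q) :
    ∃ c : ℂ, c ≠ 0 ∧ weyl v * weyl v = c • 1 := by
  choose c hc hv using fun q => weylInt_sq (v q)
  refine ⟨∏ q, (c q : ℂ), Finset.prod_ne_zero_iff.mpr fun q _ => ?_, ?_⟩
  · have := left_ne_zero_of_mul_eq_one (hc q)
    exact_mod_cast this
  · rw [weyl, tensorOp_mul, ← tensorOp_one, ← tensorOp_smul]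
    congr 1
    funext q
    rw [weylOne, ← Matrix.map_mul, hv q]
    ext x y
    rw [Matrix.map_apply, Matrix.smul_apply, Matrix.smul_apply]
    rcases eq_or_ne x y with rfl | h <;> simp [*]

/-- Weyl operators are invertible, their squares being nonzero scalars. -/
theorem weyl_mul_eq_zero {Q : Type} [Fintype Q] [DecidableEq Q] {v : SympVec Q} {M : Op Q}
    (h : weyl v * M = 0) : M = 0 := by
  obtain ⟨c, hc, hv⟩ := weyl_sq v
  have h2 : c • M = 0 := by
    rw [← one_mul M, ← smul_mul_assoc, ← hv, mul_assoc, h, mul_zero]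
  exact (smul_eq_zero.mp h2).resolve_left hc

/-! ### The symplectic action of gates -/

section Act

variable {Q : Type} [DecidableEq Q]

/-- The action of a gate on symplectic vectors. -/
def Gate.act : Gate Q → SympVec Q → SympVec Q
  | .cnot i j _, v => Function.update (Function.update v i ((v i).1, (v i).2 + (v j).2)) j
      ((v j).1 + (v i).1, (v j).2)
  | .hadamard q, v => Function.update v q ((v q).2, (v q).1)
  | .phase q, v => Function.update v q ((v q).1, (v q).2 + (v q).1)

/-- This is CNOT conjugation on control and target, read entrywise: the gate permutes basis labels
by adding the control bit to the target bit. -/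
theorem cnot_weylInt : ∀ (a b : ZMod 2 × ZMod 2) (x y x' y' : Fin 2),
    weylInt a x y * weylInt b (x' + x) (y' + y) =
      weylInt (a.1, a.2 + b.2) x y * weylInt (b.1 + a.1, b.2) x' y' := by
  decide

theorem cnot_weylOne (a b : ZMod 2 × ZMod 2) (x y x' y' : Fin 2) :
    weylOne a x y * weylOne b (x' + x) (y' + y) =
      weylOne (a.1, a.2 + b.2) x y * weylOne (b.1 + a.1, b.2) x' y' := by
  have h := congrArg (Int.castRingHom ℂ) (cnot_weylInt a b x y x' y')
  rwa [map_mul, map_mul] at h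

/-- The permutation of basis labels effected by a CNOT gate. -/
def cnotFun (i j : Q) (y : Bits Q) : Bits Q := Function.update y j (y j + y i)

theorem cnotFun_cnotFun {i j : Q} (hij : i ≠ j) (y : Bits Q) :
    cnotFun i j (cnotFun i j y) = y := by
  have h : ∀ a b : Fin 2, a + b + b = a := by decide
  funext q
  rcases eq_or_ne q j with rfl | hq <;> simp [cnotFun, *]

theorem eq_cnotFun_comm {i j : Q} (hij : i ≠ j) (x y : Bits Q) :
    x = cnotFun i j y ↔ cnotFun i j x = y := by
  constructor
  · rintro rfl
    exact cnotFun_cnotFun hij y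
  · rintro rfl
    exact (cnotFun_cnotFun hij x).symm

/-! ### Circuits -/

/-- The action of a circuit on symplectic vectors. -/
def Circuit.act : Circuit Q → SympVec Q → SympVec Q
  | [], v => v
  | g :: C, v => Circuit.act C (g.act v)

theorem Circuit.act_append (C D : Circuit Q) (v : SympVec Q) :
    Circuit.act (C ++ D) v = Circuit.act D (Circuit.act C v) := by
  induction C generalizing v with
  | nil => rfl
  | cons g C ih => exact ih _

variable [Fintype Q]

theorem cnot_mul_apply {i j : Q} (hij : i ≠ j) (M : Op Q) (x y : Bits Q) :
    ((Gate.cnot i j hij).op * M) x y = M (cnotFun i j x) y := by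
  rw [Matrix.mul_apply]
  change ∑ k, (if x = cnotFun i j k then (1 : ℂ) else 0) * M k y = _
  simp [eq_cnotFun_comm hij]

theorem mul_cnot_apply {i j : Q} (hij : i ≠ j) (M : Op Q) (x y : Bits Q) :
    (M * (Gate.cnot i j hij).op) x y = M x (cnotFun i j y) := by
  rw [Matrix.mul_apply]
  change ∑ k, M x k * (if k = cnotFun i j y then (1 : ℂ) else 0) = _
  simp

theorem prod_eq_mul_mul_prod_erase {i j : Q} (hij : i ≠ j) (f : Q → ℂ) :
    ∏ q, f q = f i * f j * ∏ q ∈ (Finset.univ.erase i).erase j, f q := by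
  rw [mul_assoc, Finset.mul_prod_erase _ f
    (Finset.mem_erase.mpr ⟨hij.symm, Finset.mem_univ j⟩),
    Finset.mul_prod_erase _ f (Finset.mem_univ i)]

theorem cnot_mul_weyl {i j : Q} (hij : i ≠ j) (v : SympVec Q) :
    (Gate.cnot i j hij).op * weyl v =
      weyl ((Gate.cnot i j hij).act v) * (Gate.cnot i j hij).op := by
  ext x y'
  -- With the column label written as an image under the permutation, both sides are products over
  -- qubits that differ only in the factors `i` and `j`.
  obtain ⟨y, rfl⟩ : ∃ y, y' = cnotFun i j y := ⟨_, (cnotFun_cnotFun hij y').symm⟩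
  rw [cnot_mul_apply, mul_cnot_apply, cnotFun_cnotFun hij]
  simp only [weyl, tensorOp, Matrix.of_apply]
  rw [prod_eq_mul_mul_prod_erase hij, prod_eq_mul_mul_prod_erase hij]
  congr 1
  · simpa [cnotFun, Gate.act, hij] using cnot_weylOne (v i) (v j) (x i) (y i) (x j) (y j)
  · refine Finset.prod_congr rfl fun q hq => ?_
    simp only [Finset.mem_erase] at hq
    simp [cnotFun, Gate.act, hq.1, hq.2.1]

/-- Conjugation turns X^a Z^b into Z^a X^b, and reordering costs the sign (-1)^(ab). Once 1/√2 is
pulled out, the identity is integral and decidable. -/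
theorem hadamard_weylOne (a : ZMod 2 × ZMod 2) :
    (((Real.sqrt 2)⁻¹ : ℂ) • !![1, 1; 1, -1]) * weylOne a =
      (sgn (a.1 * a.2) : ℂ) • (weylOne (a.2, a.1) * (((Real.sqrt 2)⁻¹ : ℂ) • !![1, 1; 1, -1])) := by
  have hM : (!![1, 1; 1, -1] : Matrix (Fin 2) (Fin 2) ℂ) =
      (!![1, 1; 1, -1] : Matrix (Fin 2) (Fin 2) ℤ).map (Int.castRingHom ℂ) := by
    ext x y
    fin_cases x <;> fin_cases y <;> simp
  have hZ : ∀ a : ZMod 2 × ZMod 2, (!![1, 1; 1, -1] : Matrix (Fin 2) (Fin 2) ℤ) * weylInt a =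
      sgn (a.1 * a.2) • (weylInt (a.2, a.1) * !![1, 1; 1, -1]) := by
    decide
  rw [Matrix.mul_smul, Matrix.smul_mul, smul_comm]
  congr 1
  rw [hM, weylOne, weylOne, ← Matrix.map_mul, ← Matrix.map_mul, hZ]
  ext x y
  rw [Matrix.map_apply, Matrix.smul_apply, Matrix.smul_apply, Matrix.map_apply, smul_eq_mul,
    map_mul, smul_eq_mul]
  rfl

theorem phase_weylOne (a : ZMod 2 × ZMod 2) :
    !![1, 0; 0, Complex.I] * weylOne a =
      (Complex.I ^ a.1.val) • (weylOne (a.1, a.2 + a.1) * !![1, 0; 0, Complex.I]) := by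
  have h2 : ∀ a : ZMod 2, a = 0 ∨ a = 1 := by decide
  have e00 : weylInt (0, 0) = !![1, 0; 0, 1] := by decide
  have e01 : weylInt (0, 1) = !![1, 0; 0, -1] := by decide
  have e10 : weylInt (1, 0) = !![0, 1; 1, 0] := by decide
  have e11 : weylInt (1, 1) = !![0, -1; 1, 0] := by decide
  have e2 : (1 + 1 : ZMod 2) = 0 := by decide
  have hv : (1 : ZMod 2).val = 1 := by decide
  obtain ⟨a, b⟩ := a
  rcases h2 a with rfl | rfl <;> rcases h2 b with rfl | rfl <;> ext x y <;>
    fin_cases x <;> fin_cases y <;>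
    simp [weylOne, e00, e01, e10, e11, e2, hv, Matrix.mul_apply, Fin.sum_univ_two]

theorem localOp_mul_weyl (q : Q) (M : Matrix (Fin 2) (Fin 2) ℂ) (c : ℂ) (v : SympVec Q)
    (a : ZMod 2 × ZMod 2) (h : M * weylOne (v q) = c • (weylOne a * M)) :
    localOp q M * weyl v = c • (weyl (Function.update v q a) * localOp q M) := by
  rw [weyl, localOp_mul_tensorOp, h, tensorOp_update_smul, weyl, tensorOp_mul_localOp]
  congr 2
  funext r
  rcases eq_or_ne r q with rfl | hr <;> simp [*]

theorem Gate.op_mul_weyl (g : Gate Q) (v : SympVec Q) :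
    ∃ c : ℂ, c ≠ 0 ∧ g.op * weyl v = c • (weyl (g.act v) * g.op) := by
  cases g with
  | cnot i j hij => exact ⟨1, one_ne_zero, by rw [cnot_mul_weyl, one_smul]⟩
  | hadamard q =>
    refine ⟨_, ?_, localOp_mul_weyl q _ _ v _ (hadamard_weylOne (v q))⟩
    exact_mod_cast left_ne_zero_of_mul_eq_one (sgn_mul_self ((v q).1 * (v q).2))
  | phase q =>
    exact ⟨_, pow_ne_zero _ Complex.I_ne_zero, localOp_mul_weyl q _ _ v _ (phase_weylOne (v q))⟩

theorem Gate.conjTranspose_op_mul_op (g : Gate Q) : (g.op)ᴴ * g.op = 1 := by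
  cases g with
  | cnot i j hij =>
    ext x y
    rw [mul_cnot_apply, Matrix.conjTranspose_apply, Matrix.one_apply]
    simp only [Gate.op, Matrix.of_apply]
    change star (if cnotFun i j y = cnotFun i j x then (1 : ℂ) else 0) = _
    simp [eq_cnotFun_comm hij, cnotFun_cnotFun hij, eq_comm]
  | hadamard q =>
    rw [Gate.op, localOp_conjTranspose, localOp_mul_localOp, ← localOp_one q]
    congr 1
    have h : ((Real.sqrt 2 : ℝ) : ℂ) * ((Real.sqrt 2 : ℝ) : ℂ) = 2 := by
      rw [← Complex.ofReal_mul, Real.mul_self_sqrt (by norm_num)]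
      norm_num
    ext x y
    fin_cases x <;> fin_cases y <;>
      simp [Matrix.mul_apply, Fin.sum_univ_two, ← mul_inv, h] <;> norm_num
  | phase q =>
    rw [Gate.op, localOp_conjTranspose, localOp_mul_localOp, ← localOp_one q]
    congr 1
    ext x y
    fin_cases x <;> fin_cases y <;> simp [Matrix.mul_apply, Fin.sum_univ_two]

theorem Circuit.op_append (C D : Circuit Q) :
    Circuit.op (C ++ D) = Circuit.op D * Circuit.op C := by
  induction C with
  | nil => exact (mul_one _).symm
  | cons g C ih =>
    change Circuit.op (C ++ D) * g.op = _
    rw [ih, mul_assoc]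
    rfl

theorem Circuit.conjTranspose_op_mul_op (C : Circuit Q) : (Circuit.op C)ᴴ * Circuit.op C = 1 := by
  induction C with
  | nil => simp [Circuit.op]
  | cons g C ih =>
    rw [Circuit.op, Matrix.conjTranspose_mul, mul_assoc, ← mul_assoc _ _ g.op, ih, one_mul,
      g.conjTranspose_op_mul_op]

theorem Circuit.op_mul_conjTranspose_op (C : Circuit Q) : Circuit.op C * (Circuit.op C)ᴴ = 1 :=
  mul_eq_one_comm.mp (Circuit.conjTranspose_op_mul_op C)

theorem Circuit.op_mul_weyl (C : Circuit Q) (v : SympVec Q) :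
    ∃ c : ℂ, c ≠ 0 ∧ Circuit.op C * weyl v = c • (weyl (Circuit.act C v) * Circuit.op C) := by
  induction C generalizing v with
  | nil => exact ⟨1, one_ne_zero, by simp [Circuit.op, Circuit.act]⟩
  | cons g C ih =>
    obtain ⟨c, hc, h⟩ := g.op_mul_weyl v
    obtain ⟨d, hd, h'⟩ := ih (g.act v)
    refine ⟨c * d, mul_ne_zero hc hd, ?_⟩
    rw [Circuit.op, mul_assoc, h, Matrix.mul_smul, ← mul_assoc, h', Matrix.smul_mul, smul_smul,
      mul_assoc]
    rfl

/-- The action of circuits preserves the symplectic form. -/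
theorem Circuit.symp_act (C : Circuit Q) (u v : SympVec Q) :
    symp (Circuit.act C u) (Circuit.act C v) = symp u v := by
  obtain ⟨c, hc, hu⟩ := Circuit.op_mul_weyl C u
  obtain ⟨d, hd, hv⟩ := Circuit.op_mul_weyl C v
  set U := Circuit.op C
  set u' := Circuit.act C u
  set v' := Circuit.act C v
  have huv : U * (weyl u * weyl v) = (c * d) • (weyl u' * weyl v' * U) := by
    rw [← mul_assoc, hu, Matrix.smul_mul, mul_assoc, hv, Matrix.mul_smul, smul_smul, mul_assoc]
  have hvu : U * (weyl v * weyl u) = (c * d) • (weyl v' * weyl u' * U) := by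
    rw [← mul_assoc, hv, Matrix.smul_mul, mul_assoc, hu, Matrix.mul_smul, smul_smul, mul_assoc,
      mul_comm c d]
  rw [weyl_comm u v, Matrix.mul_smul, hvu, weyl_comm u' v', Matrix.smul_mul, smul_comm] at huv
  have h := smul_right_injective (Op Q) (mul_ne_zero hc hd) huv
  -- Both orders of the product pass through the unitary with the same scalar; cancelling it
  -- compares the two commutation signs.
  have h' : ((sgn (symp u v) : ℂ) - sgn (symp u' v')) • (weyl v' * weyl u') = 0 := by
    have := congrArg (· * Uᴴ) h
    simp only [Matrix.smul_mul, mul_assoc] at this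
    rw [Circuit.op_mul_conjTranspose_op, mul_one] at this
    rw [sub_smul, this, sub_self]
  have h1 : (1 : Op Q) ≠ 0 := one_ne_zero
  rcases smul_eq_zero.mp h' with h' | h'
  · exact (sgn_injective (by exact_mod_cast sub_eq_zero.mp h')).symm
  · have h2 : weyl u' * 1 = 0 := by rw [mul_one, weyl_mul_eq_zero h']
    exact absurd (weyl_mul_eq_zero h2) h1

/-- CNOT and Hadamard are involutions, and the inverse of the phase gate is its cube; hence the 3.
-/
theorem Gate.exists_circuit_conjTranspose (g : Gate Q) :
    ∃ D : Circuit Q, D.length ≤ 3 ∧ Circuit.op D = (g.op)ᴴ := by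
  have key : ∀ D : Circuit Q, Circuit.op D * g.op = 1 → Circuit.op D = (g.op)ᴴ := by
    intro D h
    have h2 := mul_eq_one_comm.mp g.conjTranspose_op_mul_op
    rw [← mul_one (Circuit.op D), ← h2, ← mul_assoc, h, one_mul]
  cases g with
  | cnot i j hij =>
    refine ⟨[.cnot i j hij], by simp, key _ ?_⟩
    simp only [Circuit.op, one_mul]
    ext x y
    rw [mul_cnot_apply, Matrix.one_apply]
    change (if x = cnotFun i j (cnotFun i j y) then (1 : ℂ) else 0) = _
    rw [cnotFun_cnotFun hij]
  | hadamard q =>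
    refine ⟨[.hadamard q], by simp, key _ ?_⟩
    have h := Gate.conjTranspose_op_mul_op (Gate.hadamard q)
    rw [Circuit.op, Circuit.op, one_mul]
    convert h using 2
    rw [Gate.op, localOp_conjTranspose]
    congr 1
    ext x y
    fin_cases x <;> fin_cases y <;> simp
  | phase q =>
    refine ⟨[.phase q, .phase q, .phase q], by simp, key _ ?_⟩
    simp only [Circuit.op, one_mul, Gate.op, localOp_mul_localOp]
    rw [← localOp_one q]
    congr 1
    ext x y
    fin_cases x <;> fin_cases y <;> simp [Matrix.mul_apply, Fin.sum_univ_two]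

theorem Circuit.exists_circuit_conjTranspose (C : Circuit Q) :
    ∃ D : Circuit Q, D.length ≤ 3 * C.length ∧ Circuit.op D = (Circuit.op C)ᴴ := by
  induction C with
  | nil => exact ⟨[], by simp, by simp [Circuit.op]⟩
  | cons g C ih =>
    obtain ⟨D, hD, hop⟩ := ih
    obtain ⟨E, hE, hop'⟩ := g.exists_circuit_conjTranspose
    refine ⟨D ++ E, ?_, ?_⟩
    · rw [List.length_append, List.length_cons]
      omega
    · rw [Circuit.op_append, hop, hop', Circuit.op, Matrix.conjTranspose_mul]

/-- Every sign pattern of a symplectic vector is realised by a circuit of Pauli gates. -/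
theorem exists_circuit_sgn (f : SympVec Q) (A : Finset Q) :
    ∃ F : Circuit Q, F.length ≤ 6 * A.card ∧ ∀ w : SympVec Q, Circuit.op F * weyl w =
      (sgn (∑ q ∈ A, sympOne (f q) (w q)) : ℂ) • (weyl w * Circuit.op F) := by
  have h2 : ∀ a : ZMod 2, a = 0 ∨ a = 1 := by decide
  -- Z is the square of the phase gate P and X = H P² H, so XZ is the worst case, with 6 gates.
  have hsingle : ∀ q : Q, ∃ F : Circuit Q, F.length ≤ 6 ∧ ∃ c : ℂ,
      Circuit.op F = c • localOp q (weylOne (f q)) := by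
    intro q
    have e00 : weylInt (0, 0) = 1 := by decide
    have e01 : weylInt (0, 1) = !![1, 0; 0, -1] := by decide
    have e10 : weylInt (1, 0) = !![0, 1; 1, 0] := by decide
    have e11 : weylInt (1, 1) = !![0, -1; 1, 0] := by decide
    have hs : ((Real.sqrt 2 : ℝ) : ℂ)⁻¹ * ((Real.sqrt 2 : ℝ) : ℂ)⁻¹ = 2⁻¹ := by
      rw [← mul_inv, ← Complex.ofReal_mul, Real.mul_self_sqrt (by norm_num)]
      norm_num
    have hZ : Circuit.op [.phase q, .phase q] = localOp q !![1, 0; 0, -1] := by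
      simp only [Circuit.op, one_mul, Gate.op, localOp_mul_localOp]
      congr 1
      ext x y
      fin_cases x <;> fin_cases y <;> simp [Matrix.mul_apply, Fin.sum_univ_two]
    have hX : Circuit.op [.hadamard q, .phase q, .phase q, .hadamard q] =
        localOp q !![0, 1; 1, 0] := by
      change Circuit.op ([.hadamard q] ++ ([.phase q, .phase q] ++ [.hadamard q])) = _
      rw [Circuit.op_append, Circuit.op_append, hZ]
      simp only [Circuit.op, one_mul, Gate.op, localOp_mul_localOp]
      congr 1
      ext x y
      fin_cases x <;> fin_cases y <;>
        simp [Matrix.mul_apply, Fin.sum_univ_two, hs] <;> norm_num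
    rcases hf : f q with ⟨a, b⟩
    rcases h2 a with rfl | rfl <;> rcases h2 b with rfl | rfl
    · refine ⟨[], by simp, 1, ?_⟩
      rw [weylOne, e00, one_smul, Circuit.op, ← localOp_one q]
      congr 1
      ext x y
      fin_cases x <;> fin_cases y <;> simp
    · refine ⟨[.phase q, .phase q], by simp, 1, ?_⟩
      rw [weylOne, e01, one_smul, hZ]
      congr 1
      ext x y
      fin_cases x <;> fin_cases y <;> simp
    · refine ⟨[.hadamard q, .phase q, .phase q, .hadamard q], by simp, 1, ?_⟩
      rw [weylOne, e10, one_smul, hX]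
      congr 1
      ext x y
      fin_cases x <;> fin_cases y <;> simp
    · refine ⟨[.phase q, .phase q] ++ [.hadamard q, .phase q, .phase q, .hadamard q],
        by simp, 1, ?_⟩
      rw [weylOne, e11, one_smul, Circuit.op_append, hX, hZ, localOp_mul_localOp]
      congr 1
      ext x y
      fin_cases x <;> fin_cases y <;> simp [Matrix.mul_apply, Fin.sum_univ_two]
  induction A using Finset.induction_on with
  | empty => exact ⟨[], by simp, fun w => by simp [Circuit.op, sgn]⟩
  | insert q A hq ih =>
    obtain ⟨F, hF, hFw⟩ := ih
    obtain ⟨D, hD, c, hc⟩ := hsingle q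
    refine ⟨F ++ D, ?_, fun w => ?_⟩
    · rw [List.length_append, Finset.card_insert_of_notMem hq]
      omega
    · have hDw : Circuit.op D * weyl w =
          (sgn (sympOne (f q) (w q)) : ℂ) • (weyl w * Circuit.op D) := by
        rw [hc, Matrix.smul_mul, localOp_mul_weyl q _ _ w _ (weylOne_comm (f q) (w q)),
          Function.update_eq_self, Matrix.mul_smul, smul_comm]
      rw [Circuit.op_append, mul_assoc, hFw, Matrix.mul_smul, ← mul_assoc, hDw, Matrix.smul_mul,
        smul_smul, Finset.sum_insert hq, sgn_add, mul_assoc, Int.cast_mul, mul_comm]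

end Act

/-! ### Circuits confined to a set of qubits -/

section Reduction

variable {Q : Type} [DecidableEq Q]

/-- The symplectic vector vanishes outside of `A`. -/
def SupportedIn (A : Finset Q) (v : SympVec Q) : Prop := ∀ q ∉ A, v q = 0

/-- The action of the circuit neither changes nor uses the qubits outside of `A`. -/
def Circuit.ActsOn (A : Finset Q) (C : Circuit Q) : Prop :=
  (∀ v : SympVec Q, ∀ q ∉ A, Circuit.act C v q = v q) ∧
    ∀ v : SympVec Q, (∀ q ∈ A, v q = 0) → Circuit.act C v = v

theorem Circuit.ActsOn.nil (A : Finset Q) : Circuit.ActsOn A [] :=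
  ⟨fun _ _ _ => rfl, fun _ _ => rfl⟩

theorem Circuit.ActsOn.append {A : Finset Q} {C D : Circuit Q} (hC : Circuit.ActsOn A C)
    (hD : Circuit.ActsOn A D) : Circuit.ActsOn A (C ++ D) := by
  refine ⟨fun v q hq => ?_, fun v hv => ?_⟩
  · rw [Circuit.act_append, hD.1 _ q hq, hC.1 v q hq]
  · rw [Circuit.act_append, hC.2 v hv, hD.2 v hv]

theorem Circuit.ActsOn.mono {A B : Finset Q} {C : Circuit Q} (hC : Circuit.ActsOn A C)
    (h : A ⊆ B) : Circuit.ActsOn B C :=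
  ⟨fun v q hq => hC.1 v q fun hA => hq (h hA), fun v hv => hC.2 v fun q hq => hv q (h hq)⟩

theorem Circuit.ActsOn.supportedIn {A B : Finset Q} {C : Circuit Q} (hC : Circuit.ActsOn A C)
    (h : A ⊆ B) {v : SympVec Q} (hv : SupportedIn B v) : SupportedIn B (Circuit.act C v) :=
  fun q hq => (hC.1 v q fun hA => hq (h hA)).trans (hv q hq)

theorem Circuit.actsOn_cnot {A : Finset Q} {i j : Q} (hij : i ≠ j) (hi : i ∈ A) (hj : j ∈ A) :
    Circuit.ActsOn A [Gate.cnot i j hij] := by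
  refine ⟨fun v q hq => ?_, fun v hv => ?_⟩
  · have h1 : q ≠ i := fun h => hq (h ▸ hi)
    have h2 : q ≠ j := fun h => hq (h ▸ hj)
    simp [Circuit.act, Gate.act, h1, h2]
  · simp only [Circuit.act, Gate.act, hv i hi, hv j hj]
    funext q
    rcases eq_or_ne q j with rfl | h1
    · simp [hv q hj]
    · rcases eq_or_ne q i with rfl | h2
      · simp [h1, hv q hi]
      · simp [h1, h2]

theorem Circuit.actsOn_hadamard {A : Finset Q} {p : Q} (hp : p ∈ A) :
    Circuit.ActsOn A [Gate.hadamard p] := by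
  refine ⟨fun v q hq => ?_, fun v hv => ?_⟩
  · have h1 : q ≠ p := fun h => hq (h ▸ hp)
    simp [Circuit.act, Gate.act, h1]
  · simp only [Circuit.act, Gate.act, hv p hp]
    exact Function.update_eq_self_iff.mpr (hv p hp).symm

theorem Circuit.actsOn_phase {A : Finset Q} {p : Q} (hp : p ∈ A) :
    Circuit.ActsOn A [Gate.phase p] := by
  refine ⟨fun v q hq => ?_, fun v hv => ?_⟩
  · have h1 : q ≠ p := fun h => hq (h ▸ hp)
    simp [Circuit.act, Gate.act, h1]
  · simp only [Circuit.act, Gate.act, hv p hp]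
    exact Function.update_eq_self_iff.mpr (by rw [hv p hp]; rfl)

/-! ### Standardizing one hyperbolic pair -/

theorem zmod_two_eq (a : ZMod 2) : a = 0 ∨ a = 1 := by
  revert a; decide

/-- Local gates turn every nonzero label of a vector on `A` into `X`. -/
theorem exists_circuit_labels_X (A : Finset Q) (u : SympVec Q) :
    ∃ C : Circuit Q, Circuit.ActsOn A C ∧ C.length ≤ A.card ∧
      ∀ q ∈ A, Circuit.act C u q = 0 ∨ Circuit.act C u q = (1, 0) := by
  induction A using Finset.induction_on with
  | empty => exact ⟨[], .nil _, le_rfl, by simp⟩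
  | insert p A hp ih =>
    obtain ⟨C, hC, hl, h⟩ := ih
    have hpA := Finset.mem_insert_self p A
    obtain ⟨D, hD, hDl, hDp, hDq⟩ : ∃ D : Circuit Q, Circuit.ActsOn (insert p A) D ∧
        D.length ≤ 1 ∧ (Circuit.act D (Circuit.act C u) p = 0 ∨
          Circuit.act D (Circuit.act C u) p = (1, 0)) ∧
        ∀ q ≠ p, Circuit.act D (Circuit.act C u) q = Circuit.act C u q := by
      rcases h' : Circuit.act C u p with ⟨a, b⟩
      rcases zmod_two_eq a with rfl | rfl <;> rcases zmod_two_eq b with rfl | rfl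
      · exact ⟨[], .nil _, by simp, Or.inl h', fun q _ => rfl⟩
      · refine ⟨[.hadamard p], Circuit.actsOn_hadamard hpA, by simp, Or.inr ?_, fun q hq => ?_⟩ <;>
          simp [Circuit.act, Gate.act, *]
      · exact ⟨[], .nil _, by simp, Or.inr h', fun q _ => rfl⟩
      · refine ⟨[.phase p], Circuit.actsOn_phase hpA, by simp, Or.inr ?_, fun q hq => ?_⟩
        · simp only [Circuit.act, Gate.act, h', Function.update_self]
          decide
        · simp [Circuit.act, Gate.act, *]
    refine ⟨C ++ D, (hC.mono (Finset.subset_insert p A)).append hD, ?_, fun q hq => ?_⟩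
    · rw [List.length_append, Finset.card_insert_of_notMem hp]
      omega
    · rw [Circuit.act_append]
      rcases eq_or_ne q p with rfl | hqp
      · exact hDp
      · rw [hDq q hqp]
        exact h q ((Finset.mem_insert.mp hq).resolve_left hqp)

/-- CNOT gates with control `p` erase labels `X` on `B`. -/
theorem exists_circuit_erase {p : Q} (B : Finset Q) (hpB : p ∉ B) (u : SympVec Q)
    (hp : u p = (1, 0)) (hB : ∀ q ∈ B, u q = 0 ∨ u q = (1, 0)) :
    ∃ C : Circuit Q, Circuit.ActsOn (insert p B) C ∧ C.length ≤ B.card ∧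
      (∀ q ∈ B, Circuit.act C u q = 0) ∧ (∀ q ∉ B, Circuit.act C u q = u q) ∧
      Circuit.act C (Pi.single p (0, 1)) = Pi.single p (0, 1) := by
  induction B using Finset.induction_on with
  | empty => exact ⟨[], .nil _, le_rfl, by simp, fun q _ => rfl, rfl⟩
  | insert r B hr ih =>
    have hrp : p ≠ r := fun h => hpB (h ▸ Finset.mem_insert_self _ _)
    have hpB' : p ∉ B := fun h => hpB (Finset.mem_insert_of_mem h)
    obtain ⟨C, hC, hl, h0, h1, hZ⟩ := ih hpB' fun q hq => hB q (Finset.mem_insert_of_mem hq)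
    have hsub : insert p B ⊆ insert p (insert r B) :=
      Finset.insert_subset_insert _ (Finset.subset_insert r B)
    rcases hB r (Finset.mem_insert_self _ _) with hu | hu
    · refine ⟨C, hC.mono hsub, hl.trans (Finset.card_le_card (Finset.subset_insert r B)),
        fun q hq => ?_, fun q hq => h1 q fun h => hq (Finset.mem_insert_of_mem h), hZ⟩
      rcases Finset.mem_insert.mp hq with rfl | hq
      · rw [h1 q hr, hu]
      · exact h0 q hq
    · have hCp := (h1 p hpB').trans hp
      have hCr := (h1 r hr).trans hu
      have hact : ∀ q, q ≠ r → Circuit.act [Gate.cnot p r hrp] (Circuit.act C u) q =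
          Circuit.act C u q := by
        intro q hq
        rcases eq_or_ne q p with rfl | hqp <;> simp [Circuit.act, Gate.act, *]
      have hactr : Circuit.act [Gate.cnot p r hrp] (Circuit.act C u) r = 0 := by
        simp only [Circuit.act, Gate.act, hCp, hCr, Function.update_self]
        decide
      refine ⟨C ++ [Gate.cnot p r hrp], (hC.mono hsub).append (Circuit.actsOn_cnot hrp
        (by simp) (by simp)), ?_, fun q hq => ?_, fun q hq => ?_, ?_⟩
      · rw [List.length_append, Finset.card_insert_of_notMem hr, List.length_singleton]
        omega
      · rw [Circuit.act_append]
        rcases Finset.mem_insert.mp hq with rfl | hq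
        · exact hactr
        · rw [hact q fun h => hr (h ▸ hq), h0 q hq]
      · rw [Circuit.act_append, hact q fun h => hq (h ▸ Finset.mem_insert_self _ _),
          h1 q fun h => hq (Finset.mem_insert_of_mem h)]
      -- A CNOT propagates Z only from target to control, so Z on the control `p` is fixed. This
      -- protects the first vector of a pair while its partner is cleaned.
      · rw [Circuit.act_append, hZ]
        funext q
        rcases eq_or_ne q p with rfl | hqp
        · simp [Circuit.act, Gate.act, hrp, hrp.symm]
        · rcases eq_or_ne q r with rfl | hqr <;> simp [Circuit.act, Gate.act, *]

variable [Fintype Q]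

theorem symp_single (p : Q) (a : ZMod 2 × ZMod 2) (v : SympVec Q) :
    symp (Pi.single p a) v = sympOne a (v p) := by
  rw [symp, Finset.sum_eq_single p]
  · simp
  · intro q _ hq
    simp [hq, sympOne]
  · simp

omit [DecidableEq Q] in
theorem symp_comm (u v : SympVec Q) : symp u v = symp v u := by
  simp only [symp, sympOne]
  exact Finset.sum_congr rfl fun q _ => by ring

/-- A hyperbolic pair supported in `A` is mapped to `(Z, X)` on qubit `p` with `O(|A|)` gates. -/
theorem exists_circuit_pair (A : Finset Q) {p : Q} (hp : p ∈ A) (u v : SympVec Q)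
    (hu : SupportedIn A u) (hv : SupportedIn A v) (huv : symp u v = 1) :
    ∃ C : Circuit Q, Circuit.ActsOn A C ∧ C.length ≤ 7 * A.card ∧
      Circuit.act C u = Pi.single p (0, 1) ∧ Circuit.act C v = Pi.single p (1, 0) := by
  have hins : insert p (A.erase p) = A := Finset.insert_erase hp
  have hcard : (A.erase p).card + 1 = A.card := Finset.card_erase_add_one hp
  obtain ⟨C₁, hC₁, hl₁, h₁⟩ := exists_circuit_labels_X A u
  -- A zero vector could not pair to 1 with `v`.
  obtain ⟨r, hr⟩ : ∃ r, Circuit.act C₁ u r ≠ 0 := by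
    by_contra! h
    have h0 : Circuit.act C₁ u = 0 := funext h
    rw [← Circuit.symp_act C₁, h0] at huv
    simp [symp, sympOne] at huv
  have hrA : r ∈ A := by
    by_contra h
    exact hr (hC₁.supportedIn subset_rfl hu r h)
  obtain ⟨C₂, hC₂, hl₂, hp₂, h₂⟩ : ∃ C₂ : Circuit Q, Circuit.ActsOn A C₂ ∧ C₂.length ≤ 1 ∧
      Circuit.act C₂ (Circuit.act C₁ u) p = (1, 0) ∧ ∀ q ∈ A,
        Circuit.act C₂ (Circuit.act C₁ u) q = 0 ∨
          Circuit.act C₂ (Circuit.act C₁ u) q = (1, 0) := by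
    rcases h₁ p hp with h | h
    · have hrp : r ≠ p := by
        rintro rfl
        exact hr h
      have hr1 := (h₁ r hrA).resolve_left hr
      have hp1 : Circuit.act [Gate.cnot r p hrp] (Circuit.act C₁ u) p = (1, 0) := by
        simp [Circuit.act, Gate.act, h, hr1]
      refine ⟨[.cnot r p hrp], Circuit.actsOn_cnot hrp hrA hp, le_rfl, hp1, fun q hq => ?_⟩
      rcases eq_or_ne q p with rfl | hqp
      · exact Or.inr hp1
      · rcases eq_or_ne q r with rfl | hqr
        · simp [Circuit.act, Gate.act, h, hr1, hrp]
        · simpa [Circuit.act, Gate.act, hqp, hqr] using h₁ q hq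
    · exact ⟨[], .nil _, by simp, h, h₁⟩
  obtain ⟨C₃, hC₃, hl₃, h0₃, h1₃, -⟩ := exists_circuit_erase (A.erase p) (by simp) _ hp₂
    fun q hq => h₂ q (Finset.mem_of_mem_erase hq)
  rw [hins] at hC₃
  -- The first three circuits reduce `u` to X on `p`; the Hadamard gate makes it Z.
  set D := ((C₁ ++ C₂) ++ C₃) ++ [Gate.hadamard p] with hD
  have hDA : Circuit.ActsOn A D :=
    ((hC₁.append hC₂).append hC₃).append (Circuit.actsOn_hadamard hp)
  have hDu : Circuit.act D u = Pi.single p (0, 1) := by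
    rw [hD, Circuit.act_append, Circuit.act_append, Circuit.act_append]
    funext q
    rcases eq_or_ne q p with rfl | hqp
    · have := (h1₃ q (by simp)).trans hp₂
      simp [Circuit.act, Gate.act, this]
    · simp only [Circuit.act, Gate.act, ne_eq, hqp, not_false_eq_true, Function.update_of_ne,
        Pi.single_eq_of_ne]
      by_cases hq : q ∈ A
      · exact h0₃ q (Finset.mem_erase.mpr ⟨hqp, hq⟩)
      · rw [h1₃ q fun h => hq (Finset.mem_of_mem_erase h), hC₂.1 _ q hq, hC₁.1 _ q hq, hu q hq]
  -- The pairing with Z on `p` is still 1, so the image of `v` has X-bit 1 there.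
  have hDv : (Circuit.act D v p).1 = 1 := by
    rw [← Circuit.symp_act D, hDu, symp_single] at huv
    simpa [sympOne] using huv
  obtain ⟨C₄, hC₄, hl₄, hu₄, hv₄⟩ : ∃ C₄ : Circuit Q, Circuit.ActsOn A C₄ ∧ C₄.length ≤ 1 ∧
      Circuit.act C₄ (Pi.single p (0, 1)) = Pi.single p (0, 1) ∧
        Circuit.act C₄ (Circuit.act D v) p = (1, 0) := by
    rcases zmod_two_eq (Circuit.act D v p).2 with h | h
    · exact ⟨[], .nil _, by simp, rfl, Prod.ext hDv h⟩
    · refine ⟨[.phase p], Circuit.actsOn_phase hp, le_rfl, ?_, ?_⟩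
      · simp [Circuit.act, Gate.act]
      · simp only [Circuit.act, Gate.act, hDv, h, Function.update_self]
        decide
  -- The partner is cleaned by local gates away from `p` and CNOTs controlled by `p`, all of which
  -- fix Z on `p`.
  obtain ⟨C₅, hC₅, hl₅, h₅⟩ := exists_circuit_labels_X (A.erase p)
    (Circuit.act C₄ (Circuit.act D v))
  have hp₅ : Circuit.act C₅ (Circuit.act C₄ (Circuit.act D v)) p = (1, 0) :=
    (hC₅.1 _ p (by simp)).trans hv₄
  obtain ⟨C₆, hC₆, hl₆, h0₆, h1₆, hZ₆⟩ := exists_circuit_erase (A.erase p) (by simp) _ hp₅ h₅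
  rw [hins] at hC₆
  have hC₅' := hC₅.mono (Finset.erase_subset p A)
  refine ⟨((D ++ C₄) ++ C₅) ++ C₆, ((hDA.append hC₄).append hC₅').append hC₆, ?_, ?_, ?_⟩
  -- The lengths add up to at most 4|A|; the factor 7 leaves slack.
  · simp only [hD, List.length_append, List.length_singleton]
    omega
  · rw [Circuit.act_append, Circuit.act_append, Circuit.act_append, hDu, hu₄, hC₅.2, hZ₆]
    intro q hq
    simp [Finset.ne_of_mem_erase hq]
  · rw [Circuit.act_append, Circuit.act_append, Circuit.act_append]
    funext q
    rcases eq_or_ne q p with rfl | hqp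
    · rw [h1₆ q (by simp), hp₅]
      simp
    · rw [Pi.single_eq_of_ne hqp]
      by_cases hq : q ∈ A
      · exact h0₆ q (Finset.mem_erase.mpr ⟨hqp, hq⟩)
      · rw [h1₆ q fun h => hq (Finset.mem_of_mem_erase h), hC₅'.1 _ q hq, hC₄.1 _ q hq,
          hDA.1 _ q hq, hv q hq]

/-! ### Standardizing many hyperbolic pairs -/

variable {ι : Type} [DecidableEq ι]

/-- The vectors `u i`, `v i`, `i ∈ B`, are mutually orthogonal hyperbolic pairs. -/
def Hyperbolic (B : Finset ι) (u v : ι → SympVec Q) : Prop :=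
  ∀ i ∈ B, ∀ j ∈ B, symp (u i) (u j) = 0 ∧ symp (v i) (v j) = 0 ∧
    symp (u i) (v j) = if i = j then 1 else 0

/-- Any `β` hyperbolic pairs on `N` qubits are mapped to the pairs `(Z, X)` on prescribed qubits
by at most `L` gates. -/
def Standardizable (pos : ι → Q) (N β L : ℕ) : Prop :=
  ∀ (A : Finset Q) (B : Finset ι) (u v : ι → SympVec Q), A.card ≤ N → B.card ≤ β →
    (∀ i ∈ B, pos i ∈ A) → (∀ i ∈ B, SupportedIn A (u i) ∧ SupportedIn A (v i)) →
    Hyperbolic B u v →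
    ∃ C : Circuit Q, Circuit.ActsOn A C ∧ C.length ≤ L ∧ ∀ i ∈ B,
      Circuit.act C (u i) = Pi.single (pos i) (0, 1) ∧
        Circuit.act C (v i) = Pi.single (pos i) (1, 0)

theorem standardizable_zero (pos : ι → Q) (N : ℕ) : Standardizable pos N 0 0 := by
  intro A B u v _ hB _ _ _
  rw [Nat.le_zero, Finset.card_eq_zero] at hB
  subst hB
  exact ⟨[], .nil _, le_rfl, by simp⟩

theorem standardizable_one (pos : ι → Q) (N : ℕ) : Standardizable pos N 1 (7 * N) := by
  intro A B u v hA hB hpos hsupp hyp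
  rcases B.eq_empty_or_nonempty with rfl | ⟨i, hi⟩
  · exact ⟨[], .nil _, by simp, by simp⟩
  · obtain ⟨C, hC, hl, h⟩ := exists_circuit_pair A (hpos i hi) (u i) (v i) (hsupp i hi).1
      (hsupp i hi).2 (by simpa using (hyp i hi i hi).2.2)
    refine ⟨C, hC, hl.trans (Nat.mul_le_mul_left 7 hA), fun j hj => ?_⟩
    rw [Finset.card_le_one.mp hB j hj i hi]
    exact h

/-- Once the first pairs are (Z, X) on their positions, orthogonality makes all other vectors vanish
there. The second circuit can thus be confined to the remaining qubits and leaves the finished pairs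
alone. -/
theorem Standardizable.add {pos : ι → Q} (hinj : Function.Injective pos) {N β β' L L' : ℕ}
    (h : Standardizable pos N β L) (h' : Standardizable pos N β' L') :
    Standardizable pos N (β + β') (L + L') := by
  intro A B u v hA hB hpos hsupp hyp
  -- The minimum covers the case of fewer than `β` pairs.
  obtain ⟨B₁, hB₁, hc⟩ := Finset.exists_subset_card_eq (min_le_right β B.card)
  obtain ⟨C, hC, hl, hCuv⟩ := h A B₁ u v hA (hc.trans_le (min_le_left _ _))
    (fun i hi => hpos i (hB₁ hi)) (fun i hi => hsupp i (hB₁ hi))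
    (fun i hi j hj => hyp i (hB₁ hi) j (hB₁ hj))
  have hsub : B \ B₁ ⊆ B := Finset.sdiff_subset
  -- Pairing with Z and with X on a qubit reads off its X-bit and its Z-bit.
  have horth : ∀ i ∈ B₁, ∀ w : SympVec Q, symp (u i) w = 0 → symp (v i) w = 0 →
      Circuit.act C w (pos i) = 0 := by
    intro i hi w h1 h2
    rw [← Circuit.symp_act C, (hCuv i hi).1, symp_single] at h1
    rw [← Circuit.symp_act C, (hCuv i hi).2, symp_single] at h2
    exact Prod.ext (by simpa [sympOne] using h1) (by simpa [sympOne] using h2)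
  have hsupp' : ∀ w : SympVec Q, SupportedIn A w →
      (∀ i ∈ B₁, symp (u i) w = 0 ∧ symp (v i) w = 0) →
      SupportedIn (A \ B₁.image pos) (Circuit.act C w) := by
    intro w hw hw' q hq
    by_cases hqA : q ∈ A
    · have : q ∈ B₁.image pos := by
        by_contra hn
        exact hq (Finset.mem_sdiff.mpr ⟨hqA, hn⟩)
      obtain ⟨i, hi, rfl⟩ := Finset.mem_image.mp this
      exact horth i hi w (hw' i hi).1 (hw' i hi).2
    · exact hC.supportedIn subset_rfl hw q hqA
  obtain ⟨D, hD, hl', hDuv⟩ := h' (A \ B₁.image pos) (B \ B₁) (fun i => Circuit.act C (u i))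
    (fun i => Circuit.act C (v i)) ((Finset.card_le_card Finset.sdiff_subset).trans hA)
    (by
      rw [Finset.card_sdiff_of_subset hB₁, hc]
      omega)
    (by
      intro i hi
      rw [Finset.mem_sdiff, Finset.mem_image]
      refine ⟨hpos i (hsub hi), ?_⟩
      rintro ⟨j, hj, hji⟩
      exact (Finset.mem_sdiff.mp hi).2 (hinj hji ▸ hj))
    (by
      intro i hi
      have hne : ∀ j ∈ B₁, j ≠ i := fun j hj hji => (Finset.mem_sdiff.mp hi).2 (hji ▸ hj)
      refine ⟨hsupp' _ (hsupp i (hsub hi)).1 fun j hj => ?_,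
        hsupp' _ (hsupp i (hsub hi)).2 fun j hj => ?_⟩
      · have h1 := hyp j (hB₁ hj) i (hsub hi)
        have h2 := hyp i (hsub hi) j (hB₁ hj)
        rw [if_neg (hne j hj).symm] at h2
        exact ⟨h1.1, (symp_comm _ _).trans h2.2.2⟩
      · have h1 := hyp j (hB₁ hj) i (hsub hi)
        rw [if_neg (hne j hj)] at h1
        exact ⟨h1.2.2, h1.2.1⟩)
    (by
      intro i hi j hj
      simp only [Circuit.symp_act]
      exact hyp i (hsub hi) j (hsub hj))
  refine ⟨C ++ D, hC.append (hD.mono Finset.sdiff_subset), ?_, fun i hi => ?_⟩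
  · rw [List.length_append]
    omega
  · rw [Circuit.act_append, Circuit.act_append]
    by_cases hi₁ : i ∈ B₁
    · have hfix : ∀ a, Circuit.act D (Pi.single (pos i) a) = Pi.single (pos i) a := by
        intro a
        refine hD.2 _ fun q hq => Pi.single_eq_of_ne ?_ _
        rintro rfl
        exact (Finset.mem_sdiff.mp hq).2 (Finset.mem_image_of_mem pos hi₁)
      rw [(hCuv i hi₁).1, (hCuv i hi₁).2]
      exact ⟨hfix _, hfix _⟩
    · exact hDuv i (Finset.mem_sdiff.mpr ⟨hi, hi₁⟩)

theorem Standardizable.mul {pos : ι → Q} (hinj : Function.Injective pos) {N β L : ℕ}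
    (h : Standardizable pos N β L) (t : ℕ) : Standardizable pos N (t * β) (t * L) := by
  induction t with
  | zero => simpa using standardizable_zero pos N
  | succ t ih =>
    rw [Nat.succ_mul, Nat.succ_mul]
    exact ih.add hinj h

omit [Fintype Q] in
/-- CNOT gates between qubits of equal type confine `κ` many vectors to `4 ^ κ` qubits. -/
theorem exists_circuit_compress {κ : Type} [Fintype κ] [DecidableEq κ] (A : Finset Q) :
    ∀ (m : ℕ) (w : κ → SympVec Q),
      (A.filter fun q => ∃ k, (w k q).1 ≠ 0).card + (A.filter fun q => ∃ k, (w k q).2 ≠ 0).card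
        ≤ m →
      ∃ C : Circuit Q, Circuit.ActsOn A C ∧ C.length ≤ m ∧ ∃ A' ⊆ A,
        A'.card ≤ 4 ^ Fintype.card κ ∧ ∀ k, ∀ q ∈ A, q ∉ A' → Circuit.act C (w k) q = 0 := by
  intro m
  induction m with
  | zero =>
    intro w hw
    refine ⟨[], .nil _, le_rfl, ∅, Finset.empty_subset _, by simp, fun k q hq _ => ?_⟩
    have h1 : A.filter (fun q => ∃ k, (w k q).1 ≠ 0) = ∅ := by
      rw [← Finset.card_eq_zero]; omega
    have h2 : A.filter (fun q => ∃ k, (w k q).2 ≠ 0) = ∅ := by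
      rw [← Finset.card_eq_zero]; omega
    have h1' := Finset.filter_eq_empty_iff.mp h1 hq
    have h2' := Finset.filter_eq_empty_iff.mp h2 hq
    push Not at h1' h2'
    exact Prod.ext (h1' k) (h2' k)
  | succ m ih =>
    intro w hw
    -- If the nonzero columns are pairwise distinct, there are at most as many as functions from `κ`
    -- to the four labels.
    by_cases hinj : Set.InjOn (fun q k => w k q) (A.filter fun q => ∃ k, w k q ≠ 0 : Finset Q)
    · refine ⟨[], .nil _, by simp, A.filter fun q => ∃ k, w k q ≠ 0, Finset.filter_subset _ _,
        ?_, fun k q hq hq' => ?_⟩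
      · refine (Finset.card_le_card_of_injOn (t := Finset.univ) _ (fun _ _ => Finset.mem_univ _)
          hinj).trans_eq ?_
        simp
      · by_contra hne
        exact hq' (Finset.mem_filter.mpr ⟨hq, k, hne⟩)
    · simp only [Set.InjOn, not_forall] at hinj
      obtain ⟨p, hp, q, hq, hpq, hne⟩ := hinj
      replace hpq : ∀ k, w k p = w k q := congrFun hpq
      obtain ⟨hpA, k, hk⟩ := Finset.mem_filter.mp hp
      have hqA := (Finset.mem_filter.mp hq).1
      -- For equal columns this CNOT sends (x, z), (x, z) to (x, 0), (0, z). No new X-part or Z-part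
      -- appears, and a nonzero one disappears, so the potential `m` drops.
      set w' : κ → SympVec Q := fun k => Circuit.act [Gate.cnot p q hne] (w k) with hw'
      have hchar : ∀ a : ZMod 2, a + a = 0 := by decide
      have hp' : ∀ k, w' k p = ((w k p).1, 0) := by
        intro k
        simp [hw', Circuit.act, Gate.act, hne, hpq, hchar]
      have hq' : ∀ k, w' k q = (0, (w k q).2) := by
        intro k
        simp [hw', Circuit.act, Gate.act, hpq, hchar]
      have hr' : ∀ k r, r ≠ p → r ≠ q → w' k r = w k r := by
        intro k r h1 h2
        simp [hw', Circuit.act, Gate.act, h1, h2]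
      have hX : A.filter (fun r => ∃ k, (w' k r).1 ≠ 0) ⊆
          A.filter (fun r => ∃ k, (w k r).1 ≠ 0) := by
        refine Finset.monotone_filter_right A fun r _ => ?_
        rintro ⟨k, hk⟩
        refine ⟨k, ?_⟩
        rcases eq_or_ne r p with rfl | h1
        · simpa [hp'] using hk
        · rcases eq_or_ne r q with rfl | h2
          · simp [hq'] at hk
          · rwa [hr' k r h1 h2] at hk
      have hZ : A.filter (fun r => ∃ k, (w' k r).2 ≠ 0) ⊆
          A.filter (fun r => ∃ k, (w k r).2 ≠ 0) := by
        refine Finset.monotone_filter_right A fun r _ => ?_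
        rintro ⟨k, hk⟩
        refine ⟨k, ?_⟩
        rcases eq_or_ne r p with rfl | h1
        · simp [hp'] at hk
        · rcases eq_or_ne r q with rfl | h2
          · simpa [hq'] using hk
          · rwa [hr' k r h1 h2] at hk
      have hlt : (A.filter fun r => ∃ k, (w' k r).1 ≠ 0).card +
          (A.filter fun r => ∃ k, (w' k r).2 ≠ 0).card ≤ m := by
        have hk' : (w k p).1 ≠ 0 ∨ (w k p).2 ≠ 0 := by
          by_contra! h
          exact hk (Prod.ext h.1 h.2)
        have h1 := Finset.card_le_card hX
        have h2 := Finset.card_le_card hZ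
        rcases hk' with hk' | hk'
        · have : (A.filter fun r => ∃ k, (w' k r).1 ≠ 0).card <
              (A.filter fun r => ∃ k, (w k r).1 ≠ 0).card := by
            refine Finset.card_lt_card ((Finset.ssubset_iff_of_subset hX).mpr ⟨q, ?_, ?_⟩)
            · exact Finset.mem_filter.mpr ⟨hqA, k, by rwa [← hpq]⟩
            · simp [hq']
          omega
        · have : (A.filter fun r => ∃ k, (w' k r).2 ≠ 0).card <
              (A.filter fun r => ∃ k, (w k r).2 ≠ 0).card := by
            refine Finset.card_lt_card ((Finset.ssubset_iff_of_subset hZ).mpr ⟨p, ?_, ?_⟩)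
            · exact Finset.mem_filter.mpr ⟨hpA, k, hk'⟩
            · simp [hp']
          omega
      obtain ⟨C, hC, hl, A', hA', hcard, hzero⟩ := ih w' hlt
      refine ⟨[Gate.cnot p q hne] ++ C, (Circuit.actsOn_cnot hne hpA hqA).append hC, ?_, A', hA',
        hcard, fun k r hr hr' => ?_⟩
      · rw [List.length_append, List.length_singleton]
        omega
      · rw [Circuit.act_append]
        exact hzero k r hr hr'

/-- A block of `b` pairs has 2b vectors, hence 4^(2b) = 16^b possible columns. The additional `b`
qubits are the target positions, which compression may have discarded. -/
theorem Standardizable.compress {pos : ι → Q} {b L : ℕ}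
    (h : Standardizable pos (16 ^ b + b) b L) (N : ℕ) : Standardizable pos N b (2 * N + L) := by
  intro A B u v hA hB hpos hsupp hyp
  obtain ⟨C, hC, hl, A', hA', hcard, hzero⟩ := exists_circuit_compress (κ := B ⊕ B) A (2 * N)
    -- The potential counts each qubit at most twice, whence `2 * N`.
    (Sum.elim (fun i => u i) fun i => v i) (by
      have h1 := fun P : Q → Prop => fun _ : DecidablePred P => Finset.card_filter_le A P
      have h2 := h1 (fun q => ∃ k, (Sum.elim (fun i : B => u i) (fun i : B => v i) k q).1 ≠ 0)
        inferInstance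
      have h3 := h1 (fun q => ∃ k, (Sum.elim (fun i : B => u i) (fun i : B => v i) k q).2 ≠ 0)
        inferInstance
      omega)
  have hA'' : A' ∪ B.image pos ⊆ A := by
    refine Finset.union_subset hA' fun q hq => ?_
    obtain ⟨i, hi, rfl⟩ := Finset.mem_image.mp hq
    exact hpos i hi
  have hcard' : A'.card ≤ 16 ^ b := by
    refine hcard.trans ?_
    rw [Fintype.card_sum, Fintype.card_coe, ← two_mul, pow_mul]
    exact Nat.pow_le_pow_right (by norm_num) hB
  have hsupp' : ∀ w : SympVec Q, SupportedIn A w →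
      (∀ q ∈ A, q ∉ A' → Circuit.act C w q = 0) →
      SupportedIn (A' ∪ B.image pos) (Circuit.act C w) := by
    intro w hw hw' q hq
    rw [Finset.mem_union, not_or] at hq
    by_cases hqA : q ∈ A
    · exact hw' q hqA hq.1
    · exact hC.supportedIn subset_rfl hw q hqA
  obtain ⟨D, hD, hl', hDuv⟩ := h (A' ∪ B.image pos) B (fun i => Circuit.act C (u i))
    (fun i => Circuit.act C (v i))
    ((Finset.card_union_le _ _).trans (add_le_add hcard' (Finset.card_image_le.trans hB))) hB
    (fun i hi => Finset.mem_union_right _ (Finset.mem_image_of_mem pos hi))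
    (fun i hi => ⟨hsupp' _ (hsupp i hi).1 (hzero (Sum.inl ⟨i, hi⟩)),
      hsupp' _ (hsupp i hi).2 (hzero (Sum.inr ⟨i, hi⟩))⟩)
    (by
      intro i hi j hj
      simp only [Circuit.symp_act]
      exact hyp i hi j hj)
  refine ⟨C ++ D, hC.append (hD.mono hA''), ?_, fun i hi => ?_⟩
  · rw [List.length_append]
    omega
  · rw [Circuit.act_append, Circuit.act_append]
    exact hDuv i hi

/-- Each block is compressed and then eliminated pair by pair on the few qubits left. -/
theorem standardizable_blocks {pos : ι → Q} (hinj : Function.Injective pos) (N b t : ℕ) :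
    Standardizable pos N (t * b) (t * (2 * N + b * (7 * (16 ^ b + b)))) := by
  have h := (standardizable_one pos (16 ^ b + b)).mul hinj b
  rw [mul_one] at h
  exact (h.compress N).mul hinj t

end Reduction

/-! ### Pauli operators as Weyl operators -/

section PauliOps

variable {Q : Type} [Fintype Q] [DecidableEq Q]

/-- The binary representation of a Pauli operator, grouped by qubits. -/
def Pauli.vec {Q : Type} (g : Pauli Q) : SympVec Q :=
  fun q => ((g.label q).xBit, (g.label q).zBit)

theorem PauliLabel.exists_mat_eq_smul (M : PauliLabel) :
    ∃ c : ℂ, c ≠ 0 ∧ M.mat = c • weylOne (M.xBit, M.zBit) := by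
  have e00 : weylInt (0, 0) = !![1, 0; 0, 1] := by decide
  have e01 : weylInt (0, 1) = !![1, 0; 0, -1] := by decide
  have e10 : weylInt (1, 0) = !![0, 1; 1, 0] := by decide
  have e11 : weylInt (1, 1) = !![0, -1; 1, 0] := by decide
  cases M
  · refine ⟨1, one_ne_zero, ?_⟩
    ext x y
    fin_cases x <;> fin_cases y <;> simp [mat, xBit, zBit, weylOne, e00]
  · refine ⟨1, one_ne_zero, ?_⟩
    ext x y
    fin_cases x <;> fin_cases y <;> simp [mat, xBit, zBit, weylOne, e10]
  · refine ⟨Complex.I, Complex.I_ne_zero, ?_⟩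
    ext x y
    fin_cases x <;> fin_cases y <;> simp [mat, xBit, zBit, weylOne, e11]
  · refine ⟨1, one_ne_zero, ?_⟩
    ext x y
    fin_cases x <;> fin_cases y <;> simp [mat, xBit, zBit, weylOne, e01]

theorem PauliLabel.mat_mul_mat (M : PauliLabel) : M.mat * M.mat = 1 := by
  cases M <;> ext x y <;> fin_cases x <;> fin_cases y <;>
    simp [mat, Matrix.mul_apply, Fin.sum_univ_two]

omit [DecidableEq Q] in
theorem Pauli.exists_op_eq_smul (g : Pauli Q) : ∃ c : ℂ, c ≠ 0 ∧ g.op = c • weyl g.vec := by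
  choose c hc h using fun q => (g.label q).exists_mat_eq_smul
  refine ⟨Complex.I ^ (g.phase : ℕ) * ∏ q, c q, mul_ne_zero (pow_ne_zero _ Complex.I_ne_zero)
    (Finset.prod_ne_zero_iff.mpr fun q _ => hc q), ?_⟩
  rw [Pauli.op, funext h, tensorOp_smul, smul_smul]
  rfl

theorem Pauli.op_mul_op (g : Pauli Q) : g.op * g.op = ((-1 : ℂ) ^ (g.phase : ℕ)) • 1 := by
  rw [Pauli.op, Matrix.smul_mul, Matrix.mul_smul, smul_smul, tensorOp_mul, ← mul_pow,
    Complex.I_mul_I, ← tensorOp_one]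
  simp only [PauliLabel.mat_mul_mat]

omit [Fintype Q] in
theorem Pauli.vec_single (q : Q) (M : PauliLabel) :
    (Pauli.single q M).vec = Pi.single q (M.xBit, M.zBit) := by
  funext r
  rcases eq_or_ne r q with rfl | h
  · simp [Pauli.vec, Pauli.single]
  · simp [Pauli.vec, Pauli.single, h, PauliLabel.xBit, PauliLabel.zBit]

theorem Pauli.op_mul_op_comm (g h : Pauli Q) :
    g.op * h.op = (sgn (symp g.vec h.vec) : ℂ) • (h.op * g.op) := by
  obtain ⟨c, -, hg⟩ := g.exists_op_eq_smul
  obtain ⟨d, -, hh⟩ := h.exists_op_eq_smul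
  rw [hg, hh]
  simp only [Matrix.smul_mul, Matrix.mul_smul]
  rw [weyl_comm, smul_comm c d, smul_comm c, smul_comm d]

theorem Pauli.op_mul_op_ne_zero (g h : Pauli Q) : g.op * h.op ≠ 0 := by
  intro h0
  have hne : ∀ k : ℕ, ((-1 : ℂ) ^ k) ≠ 0 := fun k => pow_ne_zero _ (by norm_num)
  have h1 : g.op * (g.op * h.op) * h.op = 0 := by rw [h0]; simp
  rw [← mul_assoc, mul_assoc, g.op_mul_op, h.op_mul_op, Matrix.smul_mul, Matrix.mul_smul,
    one_mul, smul_smul] at h1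
  exact (smul_ne_zero (mul_ne_zero (hne _) (hne _)) one_ne_zero) h1

theorem Pauli.symp_eq_zero {g h : Pauli Q} (hc : g.op * h.op = h.op * g.op) :
    symp g.vec h.vec = 0 := by
  rcases zmod_two_eq (symp g.vec h.vec) with h0 | h0
  · exact h0
  · have h1 := Pauli.op_mul_op_comm g h
    rw [h0, hc] at h1
    have h2 : ((2 : ℂ)) • (h.op * g.op) = 0 := by
      have h3 : (sgn 1 : ℂ) = -1 := by simp [sgn]
      rw [h3, neg_one_smul] at h1
      rw [two_smul]
      exact eq_neg_iff_add_eq_zero.mp h1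
    exact absurd ((smul_eq_zero.mp h2).resolve_left two_ne_zero) (Pauli.op_mul_op_ne_zero h g)

theorem Pauli.symp_eq_one {g h : Pauli Q} (hc : g.op * h.op = -(h.op * g.op)) :
    symp g.vec h.vec = 1 := by
  rcases zmod_two_eq (symp g.vec h.vec) with h0 | h0
  · have h1 := Pauli.op_mul_op_comm g h
    rw [h0, hc] at h1
    have h2 : ((2 : ℂ)) • (h.op * g.op) = 0 := by
      have h3 : (sgn 0 : ℂ) = 1 := by simp [sgn]
      rw [h3, one_smul] at h1
      rw [two_smul]
      nth_rw 1 [← h1]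
      exact neg_add_cancel _
    exact absurd ((smul_eq_zero.mp h2).resolve_left two_ne_zero) (Pauli.op_mul_op_ne_zero h g)
  · exact h0

/-- A circuit conjugates a Hermitian Pauli operator to a signed Hermitian Pauli operator. -/
theorem Circuit.exists_sgn (C : Circuit Q) {g h : Pauli Q} (hact : Circuit.act C g.vec = h.vec)
    (hg : g.op * g.op = 1) (hh : h.op * h.op = 1) :
    ∃ a : ZMod 2, Circuit.op C * g.op = (sgn a : ℂ) • (h.op * Circuit.op C) := by
  obtain ⟨c, hc, hgc⟩ := g.exists_op_eq_smul
  obtain ⟨d, hd, hhd⟩ := h.exists_op_eq_smul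
  obtain ⟨e, he, hC⟩ := Circuit.op_mul_weyl C g.vec
  have h1 : Circuit.op C * g.op = (c * e * d⁻¹) • (h.op * Circuit.op C) := by
    rw [hgc, hhd, Matrix.mul_smul, hC, hact, Matrix.smul_mul, smul_smul, smul_smul,
      inv_mul_cancel_right₀ hd]
  -- Squaring the relation gives l² = 1, as both operators square to the identity.
  generalize c * e * d⁻¹ = l at h1
  have h2 : Circuit.op C * (g.op * g.op) = (l * l) • (h.op * h.op * Circuit.op C) := by
    rw [← mul_assoc, h1, Matrix.smul_mul, mul_assoc, h1, Matrix.mul_smul, smul_smul, ← mul_assoc]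
  rw [hg, hh, mul_one, one_mul] at h2
  have h3 : (1 - l * l) • (1 : Op Q) = 0 := by
    rw [← Circuit.op_mul_conjTranspose_op C, ← Matrix.smul_mul, sub_smul, one_smul, ← h2, sub_self,
      zero_mul]
  have h4 : l * l = 1 :=
    (sub_eq_zero.mp ((smul_eq_zero.mp h3).resolve_right one_ne_zero)).symm
  rcases mul_self_eq_one_iff.mp h4 with h5 | h5
  · exact ⟨0, by rw [h1, h5]; simp [sgn]⟩
  · exact ⟨1, by rw [h1, h5]; simp [sgn]⟩

/-- A circuit realizing the symplectic action on Hermitian Pauli operators up to signs can be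
corrected and inverted. -/
theorem Circuit.exists_inverse_conj {ι : Type} {pos : ι → Q} (hinj : Function.Injective pos)
    (C : Circuit Q) (a b : ι → ZMod 2) :
    ∃ U : Circuit Q, U.length ≤ 6 * Fintype.card Q + 3 * C.length ∧ ∀ i, ∀ g : Pauli Q,
      (Circuit.op C * g.op =
          (sgn (a i) : ℂ) • ((Pauli.single (pos i) .Z).op * Circuit.op C) →
        U.op * (Pauli.single (pos i) .Z).op * (U.op)ᴴ = g.op) ∧
      (Circuit.op C * g.op =
          (sgn (b i) : ℂ) • ((Pauli.single (pos i) .X).op * Circuit.op C) →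
        U.op * (Pauli.single (pos i) .X).op * (U.op)ᴴ = g.op) := by
  -- The Pauli operator `f` has symplectic product `a i` with Z and `b i` with X on position `i`, so
  -- it produces exactly the unwanted signs.
  obtain ⟨f, hf⟩ : ∃ f : SympVec Q, ∀ i, f (pos i) = (a i, b i) :=
    ⟨Function.extend pos (fun i => (a i, b i)) 0, fun i => hinj.extend_apply _ _ i⟩
  obtain ⟨F, hF, hFw⟩ := exists_circuit_sgn f Finset.univ
  obtain ⟨D, hD, hDop⟩ := C.exists_circuit_conjTranspose
  have key : ∀ (g h : Pauli Q) (e : ZMod 2), symp f h.vec = e →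
      Circuit.op C * g.op = (sgn e : ℂ) • (h.op * Circuit.op C) →
      Circuit.op (F ++ D) * h.op * (Circuit.op (F ++ D))ᴴ = g.op := by
    intro g h e he hg
    have h1 : Circuit.op F * h.op = (sgn e : ℂ) • (h.op * Circuit.op F) := by
      obtain ⟨c, hc, hh⟩ := h.exists_op_eq_smul
      rw [hh, Matrix.mul_smul, hFw, Matrix.smul_mul, smul_comm, ← he]
      rfl
    rw [Circuit.op_append, hDop, Matrix.conjTranspose_mul, Matrix.conjTranspose_conjTranspose,
      mul_assoc (Circuit.op C)ᴴ, h1, Matrix.mul_smul, Matrix.smul_mul, mul_assoc, mul_assoc,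
      ← mul_assoc (Circuit.op F) (Circuit.op F)ᴴ, Circuit.op_mul_conjTranspose_op, one_mul,
      ← Matrix.mul_smul, ← hg, ← mul_assoc, Circuit.conjTranspose_op_mul_op, one_mul]
  refine ⟨F ++ D, ?_, fun i g => ⟨key _ _ _ ?_, key _ _ _ ?_⟩⟩
  · rw [List.length_append]
    rw [Finset.card_univ] at hF
    omega
  · rw [Pauli.vec_single, symp_comm, symp_single, hf]
    simp [sympOne, PauliLabel.xBit, PauliLabel.zBit]
  · rw [Pauli.vec_single, symp_comm, symp_single, hf]
    simp [sympOne, PauliLabel.xBit, PauliLabel.zBit]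

end PauliOps

/-! ### Completing a partial symplectic basis -/

section Symplectic

variable {Q : Type} [Fintype Q]

theorem symp_add_left (u v w : SympVec Q) : symp (u + v) w = symp u w + symp v w := by
  simp only [symp, ← Finset.sum_add_distrib]
  refine Finset.sum_congr rfl fun q _ => ?_
  simp only [sympOne, Pi.add_apply, Prod.fst_add, Prod.snd_add]
  ring

theorem symp_smul_left (a : ZMod 2) (u w : SympVec Q) : symp (a • u) w = a * symp u w := by
  simp only [symp, Finset.mul_sum]
  refine Finset.sum_congr rfl fun q _ => ?_
  simp only [sympOne, Pi.smul_apply, Prod.smul_fst, Prod.smul_snd, smul_eq_mul]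
  ring

theorem symp_sum_left {ι : Type*} (s : Finset ι) (u : ι → SympVec Q) (w : SympVec Q) :
    symp (∑ i ∈ s, u i) w = ∑ i ∈ s, symp (u i) w := by
  classical
  induction s using Finset.induction_on with
  | empty => simp [symp, sympOne]
  | insert i s hi ih => rw [Finset.sum_insert hi, Finset.sum_insert hi, symp_add_left, ih]

/-- The symplectic form is nondegenerate: every functional is a symplectic product. -/
theorem exists_symp_eq_apply [DecidableEq Q] (φ : SympVec Q →ₗ[ZMod 2] ZMod 2) :
    ∃ w : SympVec Q, ∀ v, symp w v = φ v := by
  refine ⟨fun q => (φ (Pi.single q (0, 1)), φ (Pi.single q (1, 0))), fun v => ?_⟩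
  conv_rhs => rw [← Finset.univ_sum_single v, map_sum]
  refine Finset.sum_congr rfl fun q _ => ?_
  have h : (Pi.single q (v q) : SympVec Q) =
      (v q).2 • (Pi.single q (0, 1) : SympVec Q) + (v q).1 • (Pi.single q (1, 0) : SympVec Q) := by
    rw [← Pi.single_smul, ← Pi.single_smul, ← Pi.single_add]
    simp
  rw [h, map_add, map_smul, map_smul, sympOne, smul_eq_mul, smul_eq_mul, mul_comm,
    mul_comm (φ _) (v q).1]

/-- The prescribed values define a functional on the span; a left inverse extends it to the whole
space, where it is a symplectic product. -/
theorem exists_symp_eq [DecidableEq Q] {J : Type*} {e : J → SympVec Q}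
    (he : LinearIndependent (ZMod 2) e) (t : J → ZMod 2) :
    ∃ w : SympVec Q, ∀ j, symp w (e j) = t j := by
  obtain ⟨g, hg⟩ := LinearMap.exists_leftInverse_of_injective
    (Finsupp.linearCombination (ZMod 2) e) (LinearMap.ker_eq_bot.mpr he)
  obtain ⟨w, hw⟩ := exists_symp_eq_apply ((Finsupp.linearCombination (ZMod 2) t).comp g)
  refine ⟨w, fun j => ?_⟩
  have h := LinearMap.congr_fun hg (Finsupp.single j 1)
  simp only [LinearMap.comp_apply, Finsupp.linearCombination_single, one_smul,
    LinearMap.id_apply] at h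
  rw [hw, LinearMap.comp_apply, h, Finsupp.linearCombination_single, one_smul]

/-- Linearly independent vectors `u i`, `x j` consisting of an isotropic part and of hyperbolic
pairs are completed to mutually orthogonal hyperbolic pairs. -/
theorem exists_hyperbolic [DecidableEq Q] {s c : ℕ} (u : Fin s ⊕ Fin c → SympVec Q)
    (x : Fin c → SympVec Q) (hli : LinearIndependent (ZMod 2) (Sum.elim u x))
    (huu : ∀ i j, symp (u i) (u j) = 0) (hxx : ∀ i j, symp (x i) (x j) = 0)
    (hux : ∀ i j, symp (u i) (x j) = if i = Sum.inr j then 1 else 0) :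
    ∃ v : Fin s ⊕ Fin c → SympVec Q, (∀ j, v (Sum.inr j) = x j) ∧
      Hyperbolic Finset.univ u v := by
  -- The `d i` are dual to the isotropic vectors and orthogonal to the given pairs, but need not be
  -- orthogonal to each other.
  choose d hd using fun i : Fin s => exists_symp_eq hli
    (Sum.elim (fun j => if j = Sum.inl i then 1 else 0) fun _ => 0)
  have hdu : ∀ i j, symp (d i) (u j) = if j = Sum.inl i then 1 else 0 :=
    fun i j => hd i (Sum.inl j)
  have hdx : ∀ i j, symp (d i) (x j) = 0 := fun i j => hd i (Sum.inr j)
  have hself : ∀ w : SympVec Q, symp w w = 0 := by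
    intro w
    refine Finset.sum_eq_zero fun q _ => ?_
    have : ∀ a : ZMod 2 × ZMod 2, sympOne a a = 0 := by decide
    exact this _
  -- Symplectic Gram–Schmidt: restricting to `j < i` corrects each unordered pair exactly once, and
  -- adding vectors `u` preserves the pairings with `u` and `x`.
  set y : Fin s → SympVec Q := fun i =>
    d i + ∑ j ∈ Finset.univ.filter (· < i), symp (d i) (d j) • u (Sum.inl j) with hy
  have hyw : ∀ i w, symp (y i) w = symp (d i) w +
      ∑ j ∈ Finset.univ.filter (· < i), symp (d i) (d j) * symp (u (Sum.inl j)) w := by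
    intro i w
    rw [hy, symp_add_left, symp_sum_left]
    simp only [symp_smul_left]
  have hyu : ∀ i j, symp (y i) (u j) = if j = Sum.inl i then 1 else 0 := by
    intro i j
    rw [hyw, hdu]
    simp [huu]
  have hyx : ∀ i j, symp (y i) (x j) = 0 := by
    intro i j
    rw [hyw, hdx]
    simp [hux]
  have hyd : ∀ i j, symp (y i) (d j) =
      symp (d i) (d j) + if j < i then symp (d i) (d j) else 0 := by
    intro i j
    rw [hyw]
    congr 1
    simp only [symp_comm (u _) (d j), hdu, Sum.inl.injEq, mul_ite, mul_one, mul_zero]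
    simp
  have hyy : ∀ i j, symp (y i) (y j) = 0 := by
    intro i j
    rw [symp_comm, hyw, symp_comm (d j), hyd]
    simp only [symp_comm (u _) (y i), hyu, Sum.inl.injEq, mul_ite, mul_one, mul_zero]
    have hchar : ∀ a : ZMod 2, a + a = 0 := by decide
    rcases lt_trichotomy i j with h | h | h
    · simp [h, h.not_gt, symp_comm (d j) (d i), hchar]
    · simp [h, hself]
    · simp [h, h.not_gt, hchar]
  refine ⟨Sum.elim y x, fun j => rfl, fun i _ j _ => ⟨huu i j, ?_, ?_⟩⟩
  · rcases i with i | i <;> rcases j with j | j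
    · exact hyy i j
    · exact hyx i j
    · exact (symp_comm _ _).trans (hyx j i)
    · exact hxx i j
  · rcases j with j | j
    · exact (symp_comm _ _).trans (hyu j i)
    · exact hux i j

end Symplectic

/-! ### Operators on two registers -/

section Kron

variable {Q R : Type} [Fintype Q] [DecidableEq Q] [Fintype R] [DecidableEq R]

/-- The tensor product of operators on two registers. -/
def kron {Q R : Type} (A : Op Q) (B : Op R) : Op (Q ⊕ R) :=
  Matrix.of fun x y => A (x ∘ Sum.inl) (y ∘ Sum.inl) * B (x ∘ Sum.inr) (y ∘ Sum.inr)

theorem kron_mul_kron (A A' : Op Q) (B B' : Op R) :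
    kron A B * kron A' B' = kron (A * A') (B * B') := by
  ext x y
  simp only [kron, Matrix.mul_apply, Matrix.of_apply, Finset.sum_mul_sum, ← Finset.sum_product']
  refine Fintype.sum_equiv (Equiv.sumArrowEquivProdArrow Q R (Fin 2)) _ _ fun z => ?_
  simp only [Equiv.sumArrowEquivProdArrow, Equiv.coe_fn_mk]
  ring

omit [Fintype Q] [DecidableEq Q] in
theorem tensorId_eq_kron (U : Op Q) : tensorId (R := R) U = kron U 1 := by
  ext x y
  simp only [tensorId, kron, Matrix.of_apply, Matrix.one_apply]

theorem tensorId_mul (U V : Op Q) :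
    tensorId (R := R) (U * V) = tensorId U * tensorId V := by
  rw [tensorId_eq_kron, tensorId_eq_kron, tensorId_eq_kron, kron_mul_kron, one_mul]

omit [DecidableEq Q] in
theorem tensorId_one : tensorId (R := R) (1 : Op Q) = 1 := by
  ext x y
  simp only [tensorId, Matrix.of_apply, Matrix.one_apply]
  by_cases h : x = y
  · simp [h]
  · rw [if_neg h]
    by_cases h1 : x ∘ Sum.inl = y ∘ Sum.inl
    · have h2 : x ∘ Sum.inr ≠ y ∘ Sum.inr := fun h2 => h (funext fun q => by
        rcases q with q | q
        · exact congrFun h1 q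
        · exact congrFun h2 q)
      simp [h2]
    · simp [h1]

omit [DecidableEq Q] [DecidableEq R] in
theorem Pauli.op_extend (g : Pauli Q) (h : R → PauliLabel) :
    (g.extend h).op = kron g.op (tensorOp fun r => (h r).mat) := by
  ext x y
  simp only [Pauli.op, Pauli.extend, kron, tensorOp, Matrix.of_apply, Matrix.smul_apply,
    smul_eq_mul, Fintype.prod_sum_type, Sum.elim_inl, Sum.elim_inr, Function.comp_apply, mul_assoc]

theorem Pauli.op_extend_conj {U : Op Q} {g g' : Pauli Q} (h : R → PauliLabel)
    (hU : U * g.op * Uᴴ = g'.op) :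
    (g'.extend h).op = tensorId U * (g.extend h).op * tensorId Uᴴ := by
  rw [tensorId_eq_kron, tensorId_eq_kron, Pauli.op_extend, Pauli.op_extend, kron_mul_kron,
    kron_mul_kron, hU, one_mul, mul_one]

theorem localOp_mulVec (q : Q) (M : Matrix (Fin 2) (Fin 2) ℂ) (w : State Q) (y : Bits Q) :
    (localOp q M *ᵥ w) y = ∑ b, M (y q) b * w (Function.update y q b) := by
  rw [Matrix.mulVec, dotProduct]
  symm
  refine Fintype.sum_of_injective (Function.update y q) (Function.update_injective y q) _ _
    (fun z hz => ?_) fun b => ?_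
  · obtain ⟨r, hr, hyz⟩ : ∃ r ≠ q, y r ≠ z r := by
      by_contra! h
      refine hz ⟨z q, funext fun r => ?_⟩
      rcases eq_or_ne r q with rfl | hr <;> simp [*]
    rw [localOp, tensorOp, Matrix.of_apply, Finset.prod_eq_zero (Finset.mem_univ r), zero_mul]
    simp [hr, hyz]
  · rw [localOp, tensorOp, Matrix.of_apply, Finset.prod_eq_single q]
    · simp
    · intro r _ hr
      simp [hr]
    · simp

theorem localOp_Z_mulVec (q : Q) (w : State Q) (y : Bits Q) :
    (localOp q PauliLabel.Z.mat *ᵥ w) y = if y q = 0 then w y else -w y := by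
  have h2 : ∀ a : Fin 2, a = 0 ∨ a = 1 := by decide
  rw [localOp_mulVec, Fin.sum_univ_two]
  rcases h2 (y q) with h | h
  · have : Function.update y q 0 = y := by rw [← h, Function.update_eq_self]
    simp [h, PauliLabel.mat, this]
  · have : Function.update y q 1 = y := by rw [← h, Function.update_eq_self]
    simp [h, PauliLabel.mat, this]

theorem localOp_X_mulVec (q : Q) (w : State Q) (y : Bits Q) :
    (localOp q PauliLabel.X.mat *ᵥ w) y = w (Function.update y q (y q + 1)) := by
  have h2 : ∀ a : Fin 2, a = 0 ∨ a = 1 := by decide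
  have h11 : (1 + 1 : Fin 2) = 0 := by decide
  rw [localOp_mulVec, Fin.sum_univ_two]
  rcases h2 (y q) with h | h <;> simp [h, PauliLabel.mat, h11]

theorem Pauli.op_single_extend (q : Q) (M : PauliLabel) :
    ((Pauli.single q M).extend fun _ : R => PauliLabel.I).op = localOp (Sum.inl q) M.mat := by
  rw [Pauli.op, localOp]
  simp only [Pauli.extend, Pauli.single, Fin.val_zero, pow_zero, one_smul]
  congr 1
  funext r
  rcases r with r | r
  · rcases eq_or_ne r q with rfl | h <;> simp [*, PauliLabel.mat]
  · simp [PauliLabel.mat]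

theorem Pauli.op_single_extend_single (q : Q) (r : R) (M N : PauliLabel) :
    ((Pauli.single q M).extend (Pauli.single r N).label).op =
      localOp (Sum.inl q) M.mat * localOp (Sum.inr r) N.mat := by
  rw [Pauli.op]
  change _ = localOp (Sum.inl q) M.mat *
    tensorOp (Function.update (fun _ => 1) (Sum.inr r) N.mat)
  rw [localOp_mul_tensorOp]
  simp only [Pauli.extend, Pauli.single, Fin.val_zero, pow_zero, one_smul]
  congr 1
  funext t
  rcases t with t | t
  · rcases eq_or_ne t q with rfl | h <;> simp [*, PauliLabel.mat]
  · rcases eq_or_ne t r with rfl | h <;> simp [*, PauliLabel.mat]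

end Kron

/-! ### The initial code space -/

section Initial

variable {s c k : ℕ}

/-- The operators stabilizing the initial states. -/
def rawGenerators (s c k : ℕ) : Set (Pauli (AliceBob s c k)) :=
  fullGenerators (fun i => Pauli.single (position i) .Z) fun i =>
    Pauli.single (position (Sum.inr i)) .X

theorem forall_fullGenerators {Zbar : Fin s ⊕ Fin c → Pauli (Alice s c k)}
    {Xbar : Fin c → Pauli (Alice s c k)} {P : Pauli (AliceBob s c k) → Prop} :
    (∀ g ∈ fullGenerators Zbar Xbar, P g) ↔
      (∀ i : Fin s, P ((Zbar (Sum.inl i)).extend fun _ => PauliLabel.I)) ∧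
      (∀ i : Fin c, P ((Xbar i).extend (Pauli.single i PauliLabel.X).label)) ∧
      ∀ i : Fin c, P ((Zbar (Sum.inr i)).extend (Pauli.single i PauliLabel.Z).label) := by
  constructor
  · intro h
    exact ⟨fun i => h _ (Or.inl ⟨i, rfl⟩), fun i => h _ (Or.inr (Or.inl ⟨i, rfl⟩)),
      fun i => h _ (Or.inr (Or.inr ⟨i, rfl⟩))⟩
  · rintro ⟨h1, h2, h3⟩ g (⟨i, rfl⟩ | ⟨i, rfl⟩ | ⟨i, rfl⟩)
    exacts [h1 i, h2 i, h3 i]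

/-- The basis label `y` with both qubits of the `i`-th EPR pair flipped. -/
def flipPair (i : Fin c) (y : Bits (AliceBob s c k)) : Bits (AliceBob s c k) :=
  Function.update (Function.update y (Sum.inl (Sum.inr (Sum.inl i)))
    (y (Sum.inl (Sum.inr (Sum.inl i))) + 1)) (Sum.inr i) (y (Sum.inr i) + 1)

theorem flipPair_inl (i j : Fin c) (y : Bits (AliceBob s c k)) :
    flipPair i y (Sum.inl (Sum.inr (Sum.inl j))) =
      if j = i then y (Sum.inl (Sum.inr (Sum.inl j))) + 1
      else y (Sum.inl (Sum.inr (Sum.inl j))) := by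
  rcases eq_or_ne j i with rfl | h <;> simp [flipPair, *]

theorem flipPair_inr (i j : Fin c) (y : Bits (AliceBob s c k)) :
    flipPair i y (Sum.inr j) = if j = i then y (Sum.inr j) + 1 else y (Sum.inr j) := by
  rcases eq_or_ne j i with rfl | h <;> simp [flipPair, *]

theorem flipPair_ancilla (i : Fin c) (j : Fin s) (y : Bits (AliceBob s c k)) :
    flipPair i y (Sum.inl (Sum.inl j)) = y (Sum.inl (Sum.inl j)) := by
  simp [flipPair]

theorem flipPair_logical (i : Fin c) (j : Fin k) (y : Bits (AliceBob s c k)) :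
    flipPair i y (Sum.inl (Sum.inr (Sum.inr j))) = y (Sum.inl (Sum.inr (Sum.inr j))) := by
  simp [flipPair]

/-- Z is diagonal with entries ±1 and X permutes basis labels, so the stabilizer equations become
support and invariance conditions on amplitudes. -/
theorem rawGenerators_fix_iff (w : State (AliceBob s c k)) :
    (∀ g ∈ rawGenerators s c k, g.op *ᵥ w = w) ↔
      (∀ (i : Fin s) y, y (Sum.inl (Sum.inl i)) ≠ 0 → w y = 0) ∧
      (∀ (i : Fin c) y, w (flipPair i y) = w y) ∧
      ∀ (i : Fin c) y, y (Sum.inl (Sum.inr (Sum.inl i))) ≠ y (Sum.inr i) → w y = 0 := by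
  have h2 : ∀ a : Fin 2, a = 0 ∨ a = 1 := by decide
  have hneg : ∀ a : ℂ, -a = a ↔ a = 0 := fun a => neg_eq_self
  rw [rawGenerators, forall_fullGenerators]
  refine and_congr (forall_congr' fun i => ?_) (and_congr (forall_congr' fun i => ?_)
    (forall_congr' fun i => ?_))
  · rw [Pauli.op_single_extend, funext_iff]
    refine forall_congr' fun y => ?_
    rw [localOp_Z_mulVec]
    change (if y (Sum.inl (Sum.inl i)) = 0 then w y else -w y) = w y ↔ _
    split_ifs with h <;> simp [h, hneg]
  · rw [Pauli.op_single_extend_single, funext_iff]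
    refine forall_congr' fun y => ?_
    rw [← Matrix.mulVec_mulVec, localOp_X_mulVec, localOp_X_mulVec]
    rfl
  · rw [Pauli.op_single_extend_single, funext_iff]
    refine forall_congr' fun y => ?_
    rw [← Matrix.mulVec_mulVec, localOp_Z_mulVec, localOp_Z_mulVec]
    change (if y (Sum.inl (Sum.inr (Sum.inl i))) = 0 then _ else _) = w y ↔ _
    rcases h2 (y (Sum.inl (Sum.inr (Sum.inl i)))) with h | h <;>
      rcases h2 (y (Sum.inr i)) with h' | h' <;> simp [h, h', hneg]

/-- The basis label of the logical bits `x` in which all other bits vanish. -/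
def logicalLabel (s c : ℕ) {k : ℕ} (x : Bits (Fin k)) : Bits (AliceBob s c k) :=
  Sum.elim (Sum.elim (fun _ => 0) (Sum.elim (fun _ => 0) x)) fun _ => 0

/-- The basis label `y` with the bits of the EPR pairs in `T` reset. -/
def resetPairs (T : Finset (Fin c)) (y : Bits (AliceBob s c k)) : Bits (AliceBob s c k) :=
  Sum.elim (Sum.elim (fun i => y (Sum.inl (Sum.inl i)))
      (Sum.elim (fun i => if i ∈ T then 0 else y (Sum.inl (Sum.inr (Sum.inl i))))
        fun i => y (Sum.inl (Sum.inr (Sum.inr i)))))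
    fun i => if i ∈ T then 0 else y (Sum.inr i)

/-- Resetting a pair with equal bits does nothing or flips both. A fixed vector is therefore
determined by its amplitudes at the labels `logicalLabel`. -/
theorem apply_resetPairs {w : State (AliceBob s c k)}
    (hw : ∀ (i : Fin c) y, w (flipPair i y) = w y) (y : Bits (AliceBob s c k))
    (hy : ∀ i : Fin c, y (Sum.inl (Sum.inr (Sum.inl i))) = y (Sum.inr i)) (T : Finset (Fin c)) :
    w (resetPairs T y) = w y := by
  have h2 : ∀ a : Fin 2, a = 0 ∨ a = 1 := by decide
  have h11 : (1 + 1 : Fin 2) = 0 := by decide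
  induction T using Finset.induction_on with
  | empty =>
    congr 1
    funext q
    rcases q with (q | q | q) | q <;> simp [resetPairs]
  | insert i T hi ih =>
    rw [← ih]
    rcases h2 (y (Sum.inr i)) with h | h
    · congr 1
      funext q
      rcases q with (q | q | q) | q
      · simp [resetPairs]
      · rcases eq_or_ne q i with rfl | hq
        · simp [resetPairs, hy, h]
        · simp [resetPairs, hq]
      · simp [resetPairs]
      · rcases eq_or_ne q i with rfl | hq
        · simp [resetPairs, hy, h]
        · simp [resetPairs, hq]
    · rw [← hw i (resetPairs T y)]
      congr 1
      funext q
      rcases q with (q | q | q) | q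
      · rw [flipPair_ancilla]
        rfl
      · rw [flipPair_inl]
        rcases eq_or_ne q i with rfl | hq
        · simp [resetPairs, hy, h, hi, h11]
        · simp [resetPairs, hq]
      · rw [flipPair_logical]
        rfl
      · rw [flipPair_inr]
        rcases eq_or_ne q i with rfl | hq
        · simp [resetPairs, h, hi, h11]
        · simp [resetPairs, hq]

theorem inv_sqrt_two_ne_zero : ((Real.sqrt 2)⁻¹ : ℂ) ≠ 0 := by
  rw [ne_eq, inv_eq_zero, Complex.ofReal_eq_zero]
  positivity

theorem initialState_logicalLabel (x x' : Bits (Fin k)) :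
    initialState s c k x (logicalLabel s c x') =
      if x = x' then ((Real.sqrt 2)⁻¹ : ℂ) ^ c else 0 := by
  by_cases h : x = x'
  · simp [initialState, logicalLabel, h]
  · rw [if_neg h, initialState, if_neg]
    rintro ⟨-, -, h'⟩
    exact h (funext fun i => (h' i).symm)

theorem linearIndependent_initialState : LinearIndependent ℂ (initialState s c k) := by
  rw [Fintype.linearIndependent_iff]
  intro a ha x
  have h := congrFun ha (logicalLabel s c x)
  simp only [Finset.sum_apply, Pi.smul_apply, initialState_logicalLabel, smul_eq_mul, mul_ite,
    mul_zero, Finset.sum_ite_eq', Finset.mem_univ, if_true, Pi.zero_apply] at h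
  exact (mul_eq_zero.mp h).resolve_right (pow_ne_zero _ inv_sqrt_two_ne_zero)

theorem initialState_fixed (x : Bits (Fin k)) :
    ∀ g ∈ rawGenerators s c k, g.op *ᵥ initialState s c k x = initialState s c k x := by
  rw [rawGenerators_fix_iff]
  refine ⟨fun i y hy => if_neg fun h => hy (h.1 i), fun i y => ?_,
    fun i y hy => if_neg fun h => hy (h.2.1 i)⟩
  simp only [initialState]
  refine if_congr (and_congr ?_ (and_congr ?_ ?_)) rfl rfl
  · simp only [flipPair_ancilla]
  · refine forall_congr' fun j => ?_
    rw [flipPair_inl, flipPair_inr]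
    split_ifs <;> simp
  · simp only [flipPair_logical]

theorem mem_span_initialState_iff (w : State (AliceBob s c k)) :
    w ∈ Submodule.span ℂ (Set.range (initialState s c k)) ↔
      ∀ g ∈ rawGenerators s c k, g.op *ᵥ w = w := by
  constructor
  · intro hw g hg
    induction hw using Submodule.span_induction with
    | mem v hv =>
      obtain ⟨x, rfl⟩ := hv
      exact initialState_fixed x g hg
    | zero => exact Matrix.mulVec_zero _
    | add v v' _ _ h h' => rw [Matrix.mulVec_add, h, h']
    | smul a v _ h => rw [Matrix.mulVec_smul, h]
  · intro hw
    obtain ⟨hZ, hXX, hZZ⟩ := (rawGenerators_fix_iff w).mp hw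
    -- The coefficient is the amplitude of `w` divided by that of the initial state at the logical
    -- label.
    have hsum : w = ∑ x, ((((Real.sqrt 2)⁻¹ : ℂ) ^ c)⁻¹ * w (logicalLabel s c x)) •
        initialState s c k x := by
      funext y
      rw [Finset.sum_apply]
      simp only [Pi.smul_apply, smul_eq_mul]
      by_cases h1 : ∀ i : Fin s, y (Sum.inl (Sum.inl i)) = 0
      · by_cases h2 : ∀ i : Fin c, y (Sum.inl (Sum.inr (Sum.inl i))) = y (Sum.inr i)
        · rw [Finset.sum_eq_single fun i => y (Sum.inl (Sum.inr (Sum.inr i)))]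
          · rw [initialState, if_pos ⟨h1, h2, fun _ => rfl⟩, mul_right_comm,
              inv_mul_cancel₀ (pow_ne_zero _ inv_sqrt_two_ne_zero), one_mul,
              ← apply_resetPairs hXX y h2 Finset.univ]
            congr 1
            funext q
            rcases q with (q | q | q) | q <;> simp [resetPairs, logicalLabel, h1]
          · intro x _ hx
            rw [initialState, if_neg, mul_zero]
            rintro ⟨-, -, h⟩
            exact hx (funext fun i => (h i).symm)
          · simp
        · push Not at h2
          obtain ⟨i, hi⟩ := h2
          rw [hZZ i y hi, Finset.sum_eq_zero]
          intro x _
          rw [initialState, if_neg fun h => hi (h.2.1 i), mul_zero]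
      · push Not at h1
        obtain ⟨i, hi⟩ := h1
        rw [hZ i y hi, Finset.sum_eq_zero]
        intro x _
        rw [initialState, if_neg fun h => hi (h.1 i), mul_zero]
    rw [hsum]
    exact Submodule.sum_mem _ fun x _ =>
      Submodule.smul_mem _ _ (Submodule.subset_span ⟨x, rfl⟩)

theorem Code.mem_space_iff (𝒞 : Code s c k) (v : State (AliceBob s c k)) :
    v ∈ 𝒞.space ↔ ∀ g ∈ fullGenerators 𝒞.Zbar 𝒞.Xbar, g.op *ᵥ v = v := by
  constructor
  · intro hv g hg
    exact hv _ (Submonoid.subset_closure ⟨g, hg, rfl⟩)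
  · intro hv g hg
    induction hg using Submonoid.closure_induction with
    | mem _ h =>
      obtain ⟨g, hg, rfl⟩ := h
      exact hv g hg
    | one => exact Matrix.one_mulVec v
    | mul a b _ _ ha hb => rw [← Matrix.mulVec_mulVec, hb, ha]

/-- A circuit mapping the raw simplified stabilizers to the generators encodes the code. -/
theorem Code.isEncodedBy_of_conj (𝒞 : Code s c k) (U : Circuit (Alice s c k))
    (hZ : ∀ i, U.op * (Pauli.single (position i) .Z).op * (U.op)ᴴ = (𝒞.Zbar i).op)
    (hX : ∀ i, U.op * (Pauli.single (position (Sum.inr i)) .X).op * (U.op)ᴴ = (𝒞.Xbar i).op) :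
    𝒞.IsEncodedBy U := by
  set T : Op (AliceBob s c k) := tensorId (R := Fin c) U.op with hT
  set T' : Op (AliceBob s c k) := tensorId (R := Fin c) (U.op)ᴴ with hT'
  have hTT' : T * T' = 1 := by
    rw [hT, hT', ← tensorId_mul, Circuit.op_mul_conjTranspose_op, tensorId_one]
  have hT'T : T' * T = 1 := mul_eq_one_comm.mp hTT'
  have hconj : ∀ (M : Op (AliceBob s c k)) (v : State (AliceBob s c k)),
      (T * M * T') *ᵥ v = v ↔ M *ᵥ (T' *ᵥ v) = T' *ᵥ v := by
    intro M v
    constructor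
    · intro h
      have := congrArg (T' *ᵥ ·) h
      simp only [Matrix.mulVec_mulVec] at this
      rw [← mul_assoc, ← mul_assoc, hT'T, one_mul] at this
      rwa [Matrix.mulVec_mulVec]
    · intro h
      rw [← Matrix.mulVec_mulVec, ← Matrix.mulVec_mulVec, h, Matrix.mulVec_mulVec, hTT',
        Matrix.one_mulVec]
  -- Conjugating generators moves their common fixed space by the unitary.
  have hspace : ∀ v, v ∈ 𝒞.space ↔
      T' *ᵥ v ∈ Submodule.span ℂ (Set.range (initialState s c k)) := by
    intro v
    rw [𝒞.mem_space_iff, mem_span_initialState_iff, rawGenerators, forall_fullGenerators,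
      forall_fullGenerators]
    refine and_congr (forall_congr' fun i => ?_) (and_congr (forall_congr' fun i => ?_)
      (forall_congr' fun i => ?_))
    · rw [Pauli.op_extend_conj _ (hZ (Sum.inl i)), hconj]
    · rw [Pauli.op_extend_conj _ (hX i), hconj]
    · rw [Pauli.op_extend_conj _ (hZ (Sum.inr i)), hconj]
  have hrange : (Set.range fun x : Bits (Fin k) => T *ᵥ initialState s c k x) =
      T.mulVecLin '' Set.range (initialState s c k) := by
    rw [← Set.range_comp]
    rfl
  refine ⟨hZ, hX, ?_, ?_⟩
  · have hker : LinearMap.ker T.mulVecLin = ⊥ := by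
      refine LinearMap.ker_eq_bot.mpr (Function.LeftInverse.injective (g := (T' *ᵥ ·)) fun v => ?_)
      simp [Matrix.mulVec_mulVec, hT'T]
    exact linearIndependent_initialState.map' T.mulVecLin hker
  · rw [hrange, Submodule.span_image]
    ext v
    rw [hspace, Submodule.mem_map]
    constructor
    · rintro ⟨w, hw, rfl⟩
      rwa [Matrix.mulVecLin_apply, Matrix.mulVec_mulVec, hT'T, Matrix.one_mulVec]
    · intro hv
      exact ⟨_, hv, by rw [Matrix.mulVecLin_apply, Matrix.mulVec_mulVec, hTT', Matrix.one_mulVec]⟩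

end Initial

/-! ### Encoding circuits -/

section Encoding

variable {s c k : ℕ}

theorem position_injective : Function.Injective (position (s := s) (c := c) (k := k)) := by
  rintro (i | i) (j | j) h <;> simp_all [position]

/-- A Pauli operator squares to ±1 according to its phase alone, and extension keeps the phase; the
sign -1 would put -I into `S`. -/
theorem Pauli.op_mul_op_eq_one_of_extend {Q R : Type} [Fintype Q] [DecidableEq Q] [Fintype R]
    [DecidableEq R] {S : Submonoid (Op (Q ⊕ R))} (hS : -1 ∉ S) {g : Pauli Q}
    {h : R → PauliLabel} (hg : (g.extend h).op ∈ S) : g.op * g.op = 1 := by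
  have h1 := S.mul_mem hg hg
  rw [Pauli.op_mul_op] at h1 ⊢
  change ((-1 : ℂ) ^ (g.phase : ℕ)) • 1 ∈ S at h1
  rcases neg_one_pow_eq_or ℂ (g.phase : ℕ) with h2 | h2
  · rw [h2, one_smul]
  · rw [h2, neg_one_smul] at h1
    exact absurd h1 hS

theorem Code.Zbar_sq (𝒞 : Code s c k) (i : Fin s ⊕ Fin c) :
    (𝒞.Zbar i).op * (𝒞.Zbar i).op = 1 := by
  rcases i with i | i
  · exact Pauli.op_mul_op_eq_one_of_extend 𝒞.neg_one_notMem
      (Submonoid.subset_closure ⟨_, Or.inl ⟨i, rfl⟩, rfl⟩)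
  · exact Pauli.op_mul_op_eq_one_of_extend 𝒞.neg_one_notMem
      (Submonoid.subset_closure ⟨_, Or.inr (Or.inr ⟨i, rfl⟩), rfl⟩)

theorem Code.Xbar_sq (𝒞 : Code s c k) (i : Fin c) : (𝒞.Xbar i).op * (𝒞.Xbar i).op = 1 :=
  Pauli.op_mul_op_eq_one_of_extend 𝒞.neg_one_notMem
    (Submonoid.subset_closure ⟨_, Or.inr (Or.inl ⟨i, rfl⟩), rfl⟩)

theorem Code.linearIndependent_vec (𝒞 : Code s c k) : LinearIndependent (ZMod 2)
    (Sum.elim (fun i => (𝒞.Zbar i).vec) fun j => (𝒞.Xbar j).vec) := by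
  let f : (Alice s c k ⊕ Alice s c k → ZMod 2) →ₗ[ZMod 2] SympVec (Alice s c k) :=
    { toFun := fun r q => (r (Sum.inl q), r (Sum.inr q))
      map_add' := fun _ _ => rfl
      map_smul' := fun _ _ => rfl }
  have hf : LinearMap.ker f = ⊥ := by
    rw [LinearMap.ker_eq_bot]
    intro r r' h
    funext q
    rcases q with q | q
    · exact congrArg Prod.fst (congrFun h q)
    · exact congrArg Prod.snd (congrFun h q)
  have h : (Sum.elim (fun i => (𝒞.Zbar i).vec) fun j => (𝒞.Xbar j).vec) =
      f ∘ Sum.elim (fun i => (𝒞.Zbar i).row) fun j => (𝒞.Xbar j).row := by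
    funext j
    rcases j with j | j <;> rfl
  rw [h]
  exact 𝒞.indep.map' f hf

/-- A standardization bound for hyperbolic pairs gives a bound on encoding circuits. -/
theorem Code.exists_isEncodedBy (𝒞 : Code s c k) {L : ℕ}
    (hL : Standardizable (position (s := s) (c := c) (k := k)) (s + c + k) (s + c) L) :
    ∃ U : Circuit (Alice s c k), 𝒞.IsEncodedBy U ∧ U.length ≤ 6 * (s + c + k) + 3 * L := by
  have hcard : Fintype.card (Alice s c k) = s + c + k := by
    simp [Fintype.card_sum, add_assoc]
  obtain ⟨v, hvx, hyp⟩ := exists_hyperbolic _ _ 𝒞.linearIndependent_vec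
    (fun i j => Pauli.symp_eq_zero (𝒞.comm_ZZ i j)) (fun i j => Pauli.symp_eq_zero (𝒞.comm_XX i j))
    (fun i j => by
      split_ifs with h
      · rw [h]
        exact Pauli.symp_eq_one (𝒞.anticomm_ZX j)
      · exact Pauli.symp_eq_zero (𝒞.comm_ZX i j h))
  obtain ⟨C, -, hl, hC⟩ := hL Finset.univ Finset.univ (fun i => (𝒞.Zbar i).vec) v
    (by rw [Finset.card_univ, hcard]) (by simp) (fun i _ => Finset.mem_univ _)
    (fun i _ => ⟨fun q hq => absurd (Finset.mem_univ q) hq,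
      fun q hq => absurd (Finset.mem_univ q) hq⟩) hyp
  have hsq : ∀ q M, (Pauli.single q M : Pauli (Alice s c k)).op * (Pauli.single q M).op = 1 := by
    intro q M
    rw [Pauli.op_mul_op]
    simp [Pauli.single]
  have ha : ∀ i, ∃ a : ZMod 2, Circuit.op C * (𝒞.Zbar i).op =
      (sgn a : ℂ) • ((Pauli.single (position i) .Z).op * Circuit.op C) := by
    intro i
    refine C.exists_sgn ?_ (𝒞.Zbar_sq i) (hsq _ _)
    rw [(hC i (Finset.mem_univ i)).1, Pauli.vec_single]
    rfl
  have hb : ∀ i, ∃ b : ZMod 2, Circuit.op C * (𝒞.Xbar i).op =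
      (sgn b : ℂ) • ((Pauli.single (position (Sum.inr i)) .X).op * Circuit.op C) := by
    intro i
    refine C.exists_sgn ?_ (𝒞.Xbar_sq i) (hsq _ _)
    rw [← hvx, (hC (Sum.inr i) (Finset.mem_univ _)).2, Pauli.vec_single]
    rfl
  choose a ha using ha
  choose b hb using hb
  -- The partners of the ancilla generators are auxiliary, so their signs are free and set to 0.
  obtain ⟨U, hU, hUg⟩ := C.exists_inverse_conj position_injective a (Sum.elim 0 b)
  refine ⟨U, 𝒞.isEncodedBy_of_conj U (fun i => (hUg i _).1 (ha i))
    (fun i => (hUg (Sum.inr i) _).2 (hb i)), ?_⟩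
  rw [hcard] at hU
  omega

/-- With d = ⌊log₂ n⌋ / 8 rounded down, 16^d · 16^d = 2^(8d) ≤ n. One factor 16^d bounds the number
of pairs, the other the number of qubits; 121 = 2 + 7 · 17. -/
theorem block_cost_le {n : ℕ} (hn : n ≠ 0) :
    2 * n + (Nat.log 2 n / 8 + 1) *
      (7 * (16 ^ (Nat.log 2 n / 8 + 1) + (Nat.log 2 n / 8 + 1))) ≤ 121 * n := by
  set d := Nat.log 2 n / 8
  have h1 : d + 1 ≤ 16 ^ d := Nat.lt_pow_self (by norm_num)
  have h2 : 16 ^ d * 16 ^ d ≤ n := by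
    rw [← mul_pow, show 16 * 16 = 2 ^ 8 by norm_num, ← pow_mul]
    exact (Nat.pow_le_pow_right (by norm_num) (Nat.mul_div_le _ 8)).trans
      (Nat.pow_log_le_self 2 hn)
  have h3 : (d + 1) * (7 * (16 ^ (d + 1) + (d + 1))) ≤ 16 ^ d * (7 * (16 ^ d * 16 + 16 ^ d)) := by
    rw [pow_succ]
    gcongr
  have h4 : 16 ^ d * (7 * (16 ^ d * 16 + 16 ^ d)) = 119 * (16 ^ d * 16 ^ d) := by ring
  omega

/-- The block size dominates (log n) / 8, since log 2 ≤ 1 gives log n ≤ ⌊log₂ n⌋ + 1. -/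
theorem log_le_eight_mul (n : ℕ) :
    Real.log n ≤ 8 * ((Nat.log 2 n / 8 + 1 : ℕ) : ℝ) := by
  rcases Nat.eq_zero_or_pos n with rfl | hn
  · simp
  have h1 : (n : ℝ) ≤ 2 ^ (Nat.log 2 n + 1) := by
    exact_mod_cast (Nat.lt_pow_succ_log_self (by norm_num) n).le
  have h2 : Real.log n ≤ (Nat.log 2 n + 1 : ℕ) * Real.log 2 := by
    rw [← Real.log_pow]
    exact Real.log_le_log (by exact_mod_cast hn) h1
  have h3 : Real.log 2 ≤ 1 := by
    have := Real.log_two_lt_d9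
    linarith
  have h4 : ((Nat.log 2 n + 1 : ℕ) : ℝ) ≤ 8 * ((Nat.log 2 n / 8 + 1 : ℕ) : ℝ) := by
    exact_mod_cast (show Nat.log 2 n + 1 ≤ 8 * (Nat.log 2 n / 8 + 1) by omega)
  have h5 : (0 : ℝ) ≤ (Nat.log 2 n + 1 : ℕ) := Nat.cast_nonneg _
  nlinarith

end Encoding

end EAQ

/-! ### The final gate count -/

theorem mainTheorem2 :
    ∀ α : ℝ, 0 < α → ∃ K : ℝ, 0 < K ∧
      ∀ n s c k : ℕ, n = s + c + k → 2 ≤ n →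
        α * Real.log (n : ℝ) ≤ (n : ℝ) - (k : ℝ) + (c : ℝ) →
        ∀ 𝒞 : EAQ.Code s c k, ∃ U : EAQ.Circuit (EAQ.Alice s c k),
          𝒞.IsEncodedBy U ∧
          (U.length : ℝ) ≤ K * ((n : ℝ) * ((n : ℝ) - (k : ℝ) + (c : ℝ)) / Real.log (n : ℝ)) := by
  intro α hα
  -- The length is at most n(6 + 363t) with 363 = 3 · 121, and t ≤ 8m / log n + 1 where m = n - k +
  -- c. Replacing each constant 1 by m / (α log n) gives 369 = 6 + 363 and 2904 = 8 · 363.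
  refine ⟨369 / α + 2904, by positivity, ?_⟩
  intro n s c k hn h2 hm 𝒞
  set b := Nat.log 2 n / 8 + 1 with hb
  set t := (s + c) / b + 1 with ht
  have hbt : s + c ≤ t * b := by
    rw [ht, Nat.succ_mul]
    exact (Nat.lt_div_mul_add (Nat.succ_pos _)).le
  have hst : EAQ.Standardizable (EAQ.position (s := s) (c := c) (k := k)) (s + c + k) (s + c)
      (t * (121 * n)) := by
    intro A B u v hA hB hpos hsupp hyp
    obtain ⟨C, hC, hl, h⟩ := EAQ.standardizable_blocks EAQ.position_injective (s + c + k) b t A B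
      u v hA (hB.trans hbt) hpos hsupp hyp
    refine ⟨C, hC, hl.trans (Nat.mul_le_mul_left t ?_), h⟩
    rw [← hn]
    exact EAQ.block_cost_le (by omega)
  obtain ⟨U, hU, hlen⟩ := 𝒞.exists_isEncodedBy hst
  refine ⟨U, hU, ?_⟩
  set m : ℝ := (n : ℝ) - (k : ℝ) + (c : ℝ) with hmdef
  have hlog : 0 < Real.log n := Real.log_pos (by exact_mod_cast h2)
  have hbpos : (0 : ℝ) < b := by exact_mod_cast Nat.succ_pos _
  -- Here m = s + 2c.
  have hr : ((s + c : ℕ) : ℝ) ≤ m := by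
    rw [hmdef, hn]
    push_cast
    have : (0 : ℝ) ≤ c := Nat.cast_nonneg c
    linarith
  -- The hypothesis on the regime enters here, to absorb the additive terms.
  have h1 : 1 ≤ m / Real.log n / α := by
    rw [le_div_iff₀ hα, le_div_iff₀ hlog, one_mul]
    exact hm
  have hm0 : 0 ≤ m := (Nat.cast_nonneg _).trans hr
  have htm : (t : ℝ) ≤ 8 * (m / Real.log n) + m / Real.log n / α := by
    have h3 : (((s + c) / b : ℕ) : ℝ) ≤ 8 * (m / Real.log n) := by
      refine Nat.cast_div_le.trans ?_
      rw [div_le_iff₀ hbpos]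
      calc ((s + c : ℕ) : ℝ) ≤ m / Real.log n * Real.log n := by
            rwa [div_mul_cancel₀ _ hlog.ne']
        _ ≤ m / Real.log n * (8 * b) := by
            gcongr
            exact EAQ.log_le_eight_mul n
        _ = 8 * (m / Real.log n) * b := by ring
    rw [ht]
    push_cast
    linarith
  have hlen' : (U.length : ℝ) ≤ n * (6 + 363 * t) := by
    have : U.length ≤ n * (6 + 363 * t) := hlen.trans_eq (by rw [← hn]; ring)
    exact_mod_cast this
  calc (U.length : ℝ) ≤ n * (6 + 363 * t) := hlen'
    _ ≤ n * (6 * (m / Real.log n / α) +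
        363 * (8 * (m / Real.log n) + m / Real.log n / α)) := by
      gcongr
      linarith
    _ = (369 / α + 2904) * (n * m / Real.log n) := by
      field_simp
      ring
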